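/- **Setting.** Let $d\ge 0$, $\gamma>0$, $b>0$, and write $B(0,R)\subset\mathbb R^d$ for the Euclidean ball. Let $\xi$ be a random parameter with values in $\Xi$, let $f(\cdot;\xi)\in C^3(\mathbb R^d)$ for every $\xi\in\Xi$ and $f\in C^3(\mathbb R^d)$, where $f$ has a local minimum at $0$. Assume that the random gradients are square integrable and unbiased, $\mathbb E_\xi[\nabla f(x;\xi)]=\nabla f(x)$ for all $x$, that $f(\cdot;\xi)-\frac{\gamma}{2}\|\cdot\|^2$ is convex on $B(0,R_1)$ for every $\xi$, that $\sup_\xi\|\nabla f(0;\xi)\|\le b$, and that $R_0:=\frac{16b}{3\gamma}<R_1$. Fix $R\in(R_0,R_1]$. Let $\Sigma(x)=\mathbb E_\xi[(\nabla f(x;\xi)-\nabla f(x))\otimes(\nabla f(x;\xi)-\nabla f(x))]$ and $$\mathcal L_1=-\nabla f\cdot\nabla,\qquad \mathcal L_2=-\tfrac14\nabla\|\nabla f\|^2\cdot\nabla+\tfrac12\mathrm{Tr}(\Sigma\nabla^2).$$ For a test function $\varphi$, the coefficient functions $u_0,u_1,\dots$ of the formal expansion $\sum_\ell\eta^\ell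 u_\ell$ are the classical solutions on $B(0,R)\times[0,\infty)$ (continuous, and differentiable for $t>0$) of $$\partial_tu_0=\mathcal L_1u_0,\quad u_0(\cdot,0)=\varphi;\qquad \partial_tu_\ell=\mathcal L_1u_\ell+\mathcal L_2u_{\ell-1},\quad u_\ell(\cdot,0)=0\quad(\ell\ge1).$$ Here $C^k(B(0,R))$ denotes the functions that are $C^k$ in the ball with bounded derivatives up to order $k$, and $\|g\|_{C^k(B(0,R))}=\max_{j\le k}\sup_{B(0,R)}\|D^jg\|$. For $J=(j_1,\dots,j_k)\in\{1,\dots,d\}^k=:I_k$ put $\partial^J=\partial_{j_1}\cdots\partial_{j_k}$. Each $P$ below is a real polynomial that depends only on $d$, $\gamma$, $R$ and, where they occur, on $k$, $n$, $\gamma'$, $\gamma''$ (not on $\Xi$, $\xi$, $f$, $\varphi$, $b$, $R_1$). All estimates hold for all $t\ge0$. **Theorem.** (i) If $\varphi\in C^1(B(0,R))$, then $u_0$ exists and $$\sup_{x\in B(0,R)}|u_0(x,t)-\varphi(0)|\le R\,\|\varphi\|_{C^1(B(0,R))}\,e^{-\gamma t}.$$ For every $k\ge1$ there is $P$ such that,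 if $\varphi\in C^k(B(0,R))$ and $f\in C^{k+1}(B(0,R))$, then $u_0(\cdot,t)$ is $C^k$ in $B(0,R)$ and $$\sup_{J\in I_k}\sup_{x\in B(0,R)}|\partial^Ju_0(x,t)|\le P\big(\|\varphi\|_{C^k(B(0,R))},\|f\|_{C^{k+1}(B(0,R))}\big)e^{-\gamma t}.$$ (ii) For every $n\ge1$ and $\gamma'<\gamma$ there is $P$ such that, if $\varphi\in C^{2n+1}(B(0,R))$, $f\in C^{2n+2}(B(0,R))$ and $\Sigma\in C^{2n-1}(B(0,R))$, then $u_0,\dots,u_n$ exist, the integral $\varphi_n:=\int_0^\infty\mathcal L_2u_{n-1}(0,s)\,ds$ converges absolutely, and $$\sup_{x\in B(0,R)}|u_n(x,t)-\varphi_n|\le P\big(\|\varphi\|_{C^{2n+1}(B(0,R))},\|f\|_{C^{2n+2}(B(0,R))},\|\Sigma\|_{C^{2n-1}(B(0,R))}\big)e^{-\gamma't}.$$ For every $n\ge1$, $k\ge1$ and $\gamma''<\gamma$ there is $P$ such that, if $\varphi\in C^{k+2n}(B(0,R))$, $f\in C^{k+1+2n}(B(0,R))$ and $\Sigma\in C^{k+2n-2}(B(0,R))$,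 then $u_n(\cdot,t)$ is $C^k$ in $B(0,R)$ and $$\sup_{J\in I_k}\sup_{x\in B(0,R)}|\partial^Ju_n(x,t)|\le P\big(\|\varphi\|_{C^{k+2n}(B(0,R))},\|f\|_{C^{k+1+2n}(B(0,R))},\|\Sigma\|_{C^{k+2n-2}(B(0,R))}\big)e^{-\gamma''t}.$$ -/

import Mathlib

open Set Metric MeasureTheory

namespace SGDExpansion

noncomputable section

/-- The Euclidean space `ℝ^d`. -/
abbrev E (d : ℕ) : Type := EuclideanSpace ℝ (Fin d)

/-- The partial derivative `∂^J v = ∂_{j₁} ⋯ ∂_{j_k} v` at `x`, for `J = (j₁, …, j_k)`. -/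
def partialD {d k : ℕ} (J : Fin k → Fin d) (v : E d → ℝ) (x : E d) : ℝ :=
  iteratedFDeriv ℝ k v x (fun m => EuclideanSpace.single (J m) (1 : ℝ))

/-- The values `‖D^j g(x)‖` for `j ≤ k` and `x` in the ball `B(0, R)`. -/
def derivNorms {d : ℕ} {V : Type*} [NormedAddCommGroup V] [NormedSpace ℝ V]
    (k : ℕ) (R : ℝ) (g : E d → V) : Set ℝ :=
  {r | ∃ j ≤ k, ∃ x ∈ ball (0 : E d) R, ‖iteratedFDeriv ℝ j g x‖ = r}

/-- `g ∈ C^k(B(0, R))`: `g` is `k` times continuously differentiable in the ball and its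
derivatives up to order `k` are bounded there. -/
def IsCk {d : ℕ} {V : Type*} [NormedAddCommGroup V] [NormedSpace ℝ V]
    (k : ℕ) (R : ℝ) (g : E d → V) : Prop :=
  ContDiffOn ℝ k g (ball (0 : E d) R) ∧ BddAbove (derivNorms k R g)

/-- `‖g‖_{C^k(B(0, R))} = max_{j ≤ k} sup_{x ∈ B(0, R)} ‖D^j g(x)‖`. -/
def normCk {d : ℕ} {V : Type*} [NormedAddCommGroup V] [NormedSpace ℝ V]
    (k : ℕ) (R : ℝ) (g : E d → V) : ℝ :=
  sSup (derivNorms k R g)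

/-- The standing assumption on the objective `f`, the random functions `F ξ = f(·; ξ)` and the
law `μ` of the random parameter `ξ`. -/
structure Assumptions {d : ℕ} {Ξ : Type*} [MeasurableSpace Ξ] (μ : Measure Ξ)
    (F : Ξ → E d → ℝ) (f : E d → ℝ) (γ b R₁ : ℝ) : Prop where
  isProbabilityMeasure : IsProbabilityMeasure μ
  gamma_pos : 0 < γ
  b_pos : 0 < b
  contDiff : ContDiff ℝ 3 f
  contDiff_sample : ∀ ξ, ContDiff ℝ 3 (F ξ)
  isLocalMin : IsLocalMin f 0
  /-- The random gradients have a mean and a covariance. -/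
  memLp : ∀ x, MemLp (fun ξ => gradient (F ξ) x) 2 μ
  unbiased : ∀ x, ∫ ξ, gradient (F ξ) x ∂μ = gradient f x
  strongConvexOn : ∀ ξ, StrongConvexOn (ball (0 : E d) R₁) γ (F ξ)
  gradient_zero_le : ∀ ξ, ‖gradient (F ξ) 0‖ ≤ b
  radius_lt : 16 * b / (3 * γ) < R₁

/-- The covariance matrix `Σ(x)` of the random gradients, as the family of its entries. -/
def noiseCov {d : ℕ} {Ξ : Type*} [MeasurableSpace Ξ] (μ : Measure Ξ)
    (F : Ξ → E d → ℝ) (f : E d → ℝ) (x : E d) : Fin d → Fin d → ℝ :=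
  fun i j => ∫ ξ, (gradient (F ξ) x - gradient f x) i * (gradient (F ξ) x - gradient f x) j ∂μ

/-- `𝓛₁ v = -∇f · ∇v`. -/
def opL1 {d : ℕ} (f : E d → ℝ) (v : E d → ℝ) (x : E d) : ℝ :=
  -inner ℝ (gradient f x) (gradient v x)

/-- `𝓛₂ v = -(1/4) ∇‖∇f‖² · ∇v + (1/2) Tr(S ∇²v)`. -/
def opL2 {d : ℕ} (f : E d → ℝ) (S : E d → Fin d → Fin d → ℝ) (v : E d → ℝ) (x : E d) : ℝ :=
  -(1 / 4 : ℝ) * inner ℝ (gradient (fun y => ‖gradient f y‖ ^ 2) x) (gradient v x)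
    + (1 / 2 : ℝ) * ∑ i, ∑ j, S x i j * partialD ![j, i] v x

/-- `v` is a classical solution of `∂ₜ v = 𝓛₁ v + h`, `v(·, 0) = v₀` on `B(0, R) × [0, ∞)`:
continuous up to time `0`, jointly differentiable for positive times. -/
structure IsSolution {d : ℕ} (R : ℝ) (f : E d → ℝ) (h : E d → ℝ → ℝ) (v₀ : E d → ℝ)
    (v : E d → ℝ → ℝ) : Prop where
  continuousOn : ContinuousOn (fun p : E d × ℝ => v p.1 p.2) (ball (0 : E d) R ×ˢ Ici 0)
  differentiableOn : DifferentiableOn ℝ (fun p : E d × ℝ => v p.1 p.2) (ball (0 : E d) R ×ˢ Ioi 0)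
  initial : ∀ x ∈ ball (0 : E d) R, v x 0 = v₀ x
  equation : ∀ x ∈ ball (0 : E d) R, ∀ t > 0,
    deriv (fun s => v x s) t = opL1 f (fun y => v y t) x + h x t

/-- `u 0, …, u n` are the first coefficient functions of the formal expansion
`∑ η^ℓ u_ℓ` on `B(0, R) × [0, ∞)`:
`∂ₜ u₀ = 𝓛₁ u₀`, `u₀(·, 0) = φ`, and `∂ₜ u_ℓ = 𝓛₁ u_ℓ + 𝓛₂ u_{ℓ-1}`, `u_ℓ(·, 0) = 0` for
`1 ≤ ℓ ≤ n`. -/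
structure IsCoeffs {d : ℕ} (R : ℝ) (f : E d → ℝ) (S : E d → Fin d → Fin d → ℝ) (φ : E d → ℝ)
    (n : ℕ) (u : ℕ → E d → ℝ → ℝ) : Prop where
  zero : IsSolution R f (fun _ _ => 0) φ (u 0)
  succ : ∀ l < n,
    IsSolution R f (fun x t => opL2 f S (fun y => u l y t) x) (fun _ => 0) (u (l + 1))

end

end SGDExpansion

open SGDExpansion

namespace SGDExpansion

open scoped NNReal Topology

set_option linter.unusedSectionVars false

/-! ### Global existence for ordinary differential equations by truncation and gluing. -/

section ODE

variable {V : Type*} [NormedAddCommGroup V] [NormedSpace ℝ V]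

/-! Averaging the strong convexity of the samples makes `∇f` strongly monotone on the ball: `γ‖x -
y‖² ≤ ⟨∇f x - ∇f y, x - y⟩`. Since `0` is a critical point, the flow `X` of `-∇f` preserves the
ball, exists for all positive times and contracts distances by `e^{-γt}`. The coefficients are
obtained by transport along it: `u₀(x,t) = φ(X_t x)` and `u_{l+1}(x,t) = ∫₀ᵗ (𝓛₂ u_l(·,s))(X_{t-s}
x) ds`. The method of characteristics shows that every solution has this form
(`IsSolution.eq_duhamel`), and conversely these formulas define solutions (`isSolution_duhamel`).

The estimates rest on the derivatives of the flow. Contraction gives `‖DX_t‖ ≤ e^{-γt}`. Variation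
of constants writes `D²X_t(x)` as minus the integral over `s` of `DX_{t-s}(X_s x)` applied to
`D²g(X_s x)(DX_s, DX_s)`, where `g = ∇f`. The weight `e^{-γ(t-s)} e^{-2γs}` integrates to at most
`e^{-γt}/γ`, so by induction all spatial derivatives decay at the full rate `γ`
(`IsFlow.polyBdd_fderiv`), and so do those of `u₀`. For `u_{l+1}` the weight is `e^{-cs}
e^{-γ(t-s)}`, whose integral is at most `e^{-ct}/(γ-c)` if `c < γ`; at `c = γ` a factor `t` would
appear, which is why the rate drops slightly below `γ`. Once below, the same `c` serves for all `l`,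
and each step costs two derivatives (`coeffFun_polyBdd`).

The function `u_n` itself converges because `Du_n` decays, so that `u_n(x,t)` is close to
`u_n(0,t)`, and because `0` is fixed by the flow, so that `u_n(0,t) = ∫₀ᵗ 𝓛₂u_{n-1}(0,s) ds`, an
integral with an exponentially small tail.

Polynomial dependence on the norms comes from proving all bounds for families, in the form `M i ^ m
* w τ` with `m` independent of the index `i` (`PolyBdd`). Taking as index type all admissible data
at once (`Datum`), with `M` equal to `2` plus the norms, turns `M ^ m` into the required polynomial.
-/

theorem exists_solution_of_bounded [CompleteSpace V] {v : ℝ → V → V} {T : ℝ} (hT : 0 ≤ T) {K L : ℝ≥0}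
    (hlip : ∀ t ∈ Icc 0 T, LipschitzWith K (v t))
    (hcont : ∀ y, ContinuousOn (fun t => v t y) (Icc 0 T))
    (hb : ∀ t ∈ Icc 0 T, ∀ y, ‖v t y‖ ≤ L) (y₀ : V) :
    ∃ α : ℝ → V, α 0 = y₀ ∧ ∀ t ∈ Icc 0 T, HasDerivWithinAt α (v t (α t)) (Icc 0 T) t := by
  -- A curve of speed at most `L` cannot leave the ball of radius `L * T` by time `T`, so no
  -- smallness of `T` is needed.
  have h : IsPicardLindelof v (⟨0, left_mem_Icc.2 hT⟩ : Icc 0 T) y₀ (L * T.toNNReal) 0 L K :=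
    { lipschitzOnWith := fun t ht => (hlip t ht).lipschitzOnWith
      continuousOn := fun y _ => hcont y
      norm_le := fun t ht y _ => hb t ht y
      mul_max_le := by simp [hT] }
  exact h.exists_eq_forall_mem_Icc_hasDerivWithinAt₀

/-- Solutions on the intervals `[0, n]` agree by uniqueness, so they glue. Membership in `S` is
carried along because the Lipschitz condition holds only there. -/
theorem exists_global_solution {v : ℝ → V → V} {S : Set V} {y₀ : V}
    (hlip : ∀ n : ℕ, ∃ K : ℝ≥0, ∀ t ∈ Icc (0 : ℝ) n, LipschitzOnWith K (v t) S)
    (h : ∀ n : ℕ, ∃ α : ℝ → V, α 0 = y₀ ∧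
      ∀ t ∈ Icc (0 : ℝ) n, α t ∈ S ∧ HasDerivWithinAt α (v t (α t)) (Icc (0 : ℝ) n) t) :
    ∃ α : ℝ → V, α 0 = y₀ ∧ ∀ t, 0 ≤ t → α t ∈ S ∧ HasDerivWithinAt α (v t (α t)) (Ici 0) t := by
  choose α h0 hα using h
  have hder : ∀ (n : ℕ) (t : ℝ), t ∈ Ico (0 : ℝ) n →
      HasDerivWithinAt (α n) (v t (α n t)) (Ici 0) t := fun n t ht =>
    ((hα n t ⟨ht.1, ht.2.le⟩).2).mono_of_mem_nhdsWithin
      (by rw [← Ici_inter_Iic]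
          exact Filter.inter_mem self_mem_nhdsWithin (mem_nhdsWithin_of_mem_nhds (Iic_mem_nhds ht.2)))
  have hcont : ∀ n : ℕ, ContinuousOn (α n) (Icc (0 : ℝ) n) := fun n t ht =>
    (hα n t ht).2.continuousWithinAt
  have heq : ∀ (m n : ℕ), m ≤ n → EqOn (α m) (α n) (Icc (0 : ℝ) m) := by
    intro m n hmn
    obtain ⟨K, hK⟩ := hlip m
    have hmn' : (m : ℝ) ≤ n := by exact_mod_cast hmn
    refine ODE_solution_unique_of_mem_Icc_right (v := v) (s := fun _ => S) (K := K)
      (fun t ht => hK t ⟨ht.1, ht.2.le⟩) (hcont m)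
      (fun t ht => (hder m t ht).mono (Ici_subset_Ici.2 ht.1))
      (fun t ht => (hα m t ⟨ht.1, ht.2.le⟩).1)
      ((hcont n).mono (Icc_subset_Icc_right hmn'))
      (fun t ht => (hder n t ⟨ht.1, ht.2.trans_le hmn'⟩).mono (Ici_subset_Ici.2 ht.1))
      (fun t ht => (hα n t ⟨ht.1, ht.2.le.trans hmn'⟩).1) (by rw [h0, h0])
  have hfl : ∀ t : ℝ, t < ((⌊t⌋₊ + 1 : ℕ) : ℝ) := fun t => by
    push_cast; exact Nat.lt_floor_add_one t
  have hval : ∀ (n : ℕ) (t : ℝ), 0 ≤ t → t < n → α (⌊t⌋₊ + 1) t = α n t := by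
    intro n t ht htn
    exact heq _ _ ((Nat.floor_lt ht).2 htn) ⟨ht, (hfl t).le⟩
  -- The index `⌊t⌋₊ + 1` is strictly larger than `t`, so near `t` the half-line looks like the
  -- interval on which that solution lives.
  refine ⟨fun t => α (⌊t⌋₊ + 1) t, by simp [h0], fun t ht => ⟨(hα _ t ⟨ht, (hfl t).le⟩).1, ?_⟩⟩
  refine (hder _ t ⟨ht, hfl t⟩).congr_of_eventuallyEq ?_ rfl
  filter_upwards [self_mem_nhdsWithin, mem_nhdsWithin_of_mem_nhds (Iio_mem_nhds (hfl t))] with s hs hs'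
  exact hval _ s hs hs'

theorem exists_linear_solution [FiniteDimensional ℝ V] {A : ℝ → V →L[ℝ] V}
    (hA : ContinuousOn A (Ici 0)) (y₀ : V) :
    ∃ y : ℝ → V, y 0 = y₀ ∧ ∀ t, 0 ≤ t → HasDerivWithinAt y (A t (y t)) (Ici 0) t := by
  have : CompleteSpace V := FiniteDimensional.complete ℝ V
  have hbound : ∀ n : ℕ, ∃ C : ℝ≥0, ∀ t ∈ Icc (0 : ℝ) n, ‖A t‖₊ ≤ C := by
    intro n
    obtain ⟨C, hC⟩ := isCompact_Icc.exists_bound_of_continuousOn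
      (hA.mono (fun t (ht : t ∈ Icc (0 : ℝ) n) => ht.1))
    refine ⟨C.toNNReal, fun t ht => ?_⟩
    rw [← NNReal.coe_le_coe, coe_nnnorm]
    exact (hC t ht).trans (Real.le_coe_toNNReal C)
  suffices H : ∃ y : ℝ → V, y 0 = y₀ ∧ ∀ t, 0 ≤ t → y t ∈ (univ : Set V) ∧
      HasDerivWithinAt y (A t (y t)) (Ici 0) t by
    obtain ⟨y, h0, hy⟩ := H
    exact ⟨y, h0, fun t ht => (hy t ht).2⟩
  refine exists_global_solution (v := fun t y => A t y) ?_ ?_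
  · intro n
    obtain ⟨C, hC⟩ := hbound n
    exact ⟨C, fun t ht => ((A t).lipschitz.weaken (hC t ht)).lipschitzOnWith⟩
  intro n
  obtain ⟨C, hC⟩ := hbound n
  -- A priori bound on `[0, n]`: the truncated field still satisfies `‖A t (χ y • y)‖ ≤ C‖y‖`, so
  -- Grönwall keeps its solution inside the region where `χ = 1`, and there it solves the linear
  -- equation.
  set ρ : ℝ := gronwallBound ‖y₀‖ C 0 n + 1 with hρ
  have hg0 : 0 < ρ := by
    rw [hρ, gronwallBound_ε0]; positivity
  let χ : ContDiffBump (0 : V) := ⟨ρ, ρ + 1, hg0, by linarith⟩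
  have hκs : ContDiff ℝ 1 (fun y : V => χ y • y) := χ.contDiff.smul contDiff_id
  have hκc : HasCompactSupport (fun y : V => χ y • y) := χ.hasCompactSupport.smul_right
  obtain ⟨K, hK⟩ := hκs.lipschitzWith_of_hasCompactSupport hκc (by simp)
  obtain ⟨L, hL⟩ := hκc.exists_bound_of_continuous hκs.continuous
  have hκle : ∀ y : V, ‖χ y • y‖ ≤ ‖y‖ := fun y => by
    rw [norm_smul, Real.norm_of_nonneg χ.nonneg]
    exact mul_le_of_le_one_left (norm_nonneg _) χ.le_one
  have hL0 : 0 ≤ L := (norm_nonneg _).trans (hL 0)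
  have hC' : ∀ t ∈ Icc (0 : ℝ) n, ‖A t‖ ≤ C := fun t ht => by
    have := hC t ht
    rwa [← NNReal.coe_le_coe, coe_nnnorm] at this
  obtain ⟨α, h0, hα⟩ := exists_solution_of_bounded (v := fun t y => A t (χ y • y))
    (Nat.cast_nonneg n) (K := C * K) (L := C * L.toNNReal)
    (fun t ht => ((A t).lipschitz.weaken (hC t ht)).comp hK)
    (fun y => (hA.mono fun t ht => ht.1).clm_apply continuousOn_const)
    (fun t ht y => by
      push_cast
      rw [Real.coe_toNNReal _ hL0]
      exact ((A t).le_opNorm _).trans (mul_le_mul (hC' t ht) (hL y) (norm_nonneg _) C.coe_nonneg)) y₀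
  have hαb : ∀ t ∈ Icc (0 : ℝ) n, ‖α t‖ ≤ gronwallBound ‖y₀‖ C 0 (t - 0) := by
    refine norm_le_gronwallBound_of_norm_deriv_right_le
      (fun t ht => (hα t ht).continuousWithinAt) (f' := fun t => A t (χ (α t) • α t))
      (fun t ht => ?_) (by rw [h0]) (fun t ht => ?_)
    · exact (hα t ⟨ht.1, ht.2.le⟩).mono_of_mem_nhdsWithin (by
        rw [← Ici_inter_Iic]
        exact Filter.inter_mem (mem_nhdsWithin.2 ⟨univ, isOpen_univ, trivial, fun s hs =>
          ht.1.trans hs.2⟩) (mem_nhdsWithin_of_mem_nhds (Iic_mem_nhds ht.2)))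
    · rw [add_zero]
      exact ((A t).le_opNorm _).trans (mul_le_mul (hC' t ⟨ht.1, ht.2.le⟩) (hκle _)
        (norm_nonneg _) C.coe_nonneg)
  refine ⟨α, h0, fun t ht => ⟨trivial, ?_⟩⟩
  have h1 : χ (α t) = 1 := by
    refine χ.one_of_mem_closedBall ?_
    rw [mem_closedBall_zero_iff]
    refine (hαb t ht).trans ?_
    have := gronwallBound_mono (norm_nonneg y₀) le_rfl C.coe_nonneg (show t - 0 ≤ n by simpa using ht.2)
    exact this.trans (le_add_of_nonneg_right zero_le_one)
  have := hα t ht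
  simpa only [h1, one_smul] using this

end ODE

/-! ### The contracting semiflow of a strongly monotone field. -/

section Flow

variable {H : Type*} [NormedAddCommGroup H] [InnerProductSpace ℝ H]

/-- `g` is a `C²` vector field with zero `0` that is strongly monotone on `B(0, R)`. -/
structure IsMonotoneField (γ R : ℝ) (g : H → H) : Prop where
  contDiff : ContDiff ℝ 2 g
  zero : g 0 = 0
  mono : ∀ x ∈ ball (0 : H) R, ∀ y ∈ ball (0 : H) R, γ * ‖x - y‖ ^ 2 ≤ inner ℝ (g x - g y) (x - y)

/-- `X` is the semiflow of `-g` on `B(0, R)`. -/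
structure IsFlow (R : ℝ) (g : H → H) (X : ℝ → H → H) : Prop where
  init : ∀ x ∈ ball (0 : H) R, X 0 x = x
  mem : ∀ x ∈ ball (0 : H) R, ∀ t, 0 ≤ t → X t x ∈ ball (0 : H) R
  deriv : ∀ x ∈ ball (0 : H) R, ∀ t, 0 ≤ t →
    HasDerivWithinAt (fun s => X s x) (-(g (X t x))) (Ici 0) t

theorem antitoneOn_Ici_of_hasDerivWithinAt_nonpos {f f' : ℝ → ℝ}
    (h : ∀ t, 0 ≤ t → HasDerivWithinAt f (f' t) (Ici 0) t) (h' : ∀ t, 0 ≤ t → f' t ≤ 0) :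
    AntitoneOn f (Ici 0) := by
  have hd : ∀ t ∈ interior (Ici (0 : ℝ)), HasDerivAt f (f' t) t := fun t ht =>
    (h t (interior_subset ht)).hasDerivAt (mem_interior_iff_mem_nhds.1 ht)
  refine antitoneOn_of_deriv_nonpos (convex_Ici 0) (fun t ht => (h t ht).continuousWithinAt)
    (fun t ht => (hd t ht).differentiableAt.differentiableWithinAt) fun t ht => ?_
  rw [(hd t ht).deriv]
  exact h' t (interior_subset ht)

/-- Strong monotonicity says exactly that `e^{2γt}‖α - β‖²` is nonincreasing. Besides contraction
this yields uniqueness and the semigroup law. -/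
theorem norm_sub_le_of_solutions {γ R : ℝ} {g : H → H} (hg : IsMonotoneField γ R g) {α β : ℝ → H}
    (hα : ∀ t, 0 ≤ t → α t ∈ ball (0 : H) R ∧ HasDerivWithinAt α (-(g (α t))) (Ici 0) t)
    (hβ : ∀ t, 0 ≤ t → β t ∈ ball (0 : H) R ∧ HasDerivWithinAt β (-(g (β t))) (Ici 0) t)
    {t : ℝ} (ht : 0 ≤ t) : ‖α t - β t‖ ≤ Real.exp (-γ * t) * ‖α 0 - β 0‖ := by
  have hexp : ∀ s, HasDerivAt (fun s => Real.exp (2 * γ * s)) (Real.exp (2 * γ * s) * (2 * γ)) s := by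
    intro s
    simpa using ((hasDerivAt_id s).const_mul (2 * γ)).exp
  have key := antitoneOn_Ici_of_hasDerivWithinAt_nonpos
    (f := fun s => Real.exp (2 * γ * s) * ‖α s - β s‖ ^ 2)
    (fun s hs => (hexp s).hasDerivWithinAt.mul ((hα s hs).2.sub (hβ s hs).2).norm_sq)
    (fun s hs => by
      have h1 := hg.mono _ (hα s hs).1 _ (hβ s hs).1
      have h2 : inner ℝ (α s - β s) (-g (α s) - -g (β s)) = -inner ℝ (g (α s) - g (β s)) (α s - β s) := by
        rw [real_inner_comm, ← inner_neg_left]; congr 1; abel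
      simp only [Pi.sub_apply, h2]
      have := Real.exp_pos (2 * γ * s)
      nlinarith) (mem_Ici.2 le_rfl) ht ht
  simp only [mul_zero, Real.exp_zero, one_mul] at key
  have h3 : ‖α t - β t‖ ^ 2 ≤ (Real.exp (-γ * t) * ‖α 0 - β 0‖) ^ 2 := by
    have h4 : Real.exp (-γ * t) ^ 2 * Real.exp (2 * γ * t) = 1 := by
      rw [sq, ← Real.exp_add, ← Real.exp_add]; ring_nf; simp
    calc ‖α t - β t‖ ^ 2 = Real.exp (-γ * t) ^ 2 * (Real.exp (2 * γ * t) * ‖α t - β t‖ ^ 2) := by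
          rw [← mul_assoc, h4, one_mul]
      _ ≤ Real.exp (-γ * t) ^ 2 * ‖α 0 - β 0‖ ^ 2 := by gcongr
      _ = _ := by ring
  exact (pow_le_pow_iff_left₀ (norm_nonneg _) (by positivity) two_ne_zero).1 h3

section FiniteDimensional

variable [FiniteDimensional ℝ H]

theorem IsMonotoneField.exists_lipschitzOnWith {γ R : ℝ} {g : H → H} (hg : IsMonotoneField γ R g) :
    ∃ K, LipschitzOnWith K g (ball 0 R) := by
  obtain ⟨K, hK⟩ := (hg.contDiff.contDiffOn (s := closedBall 0 R)).exists_lipschitzOnWith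
    two_ne_zero (convex_closedBall 0 R) (isCompact_closedBall 0 R)
  exact ⟨K, hK.mono ball_subset_closedBall⟩

theorem IsMonotoneField.exists_lipschitzOnWith_fderiv {γ R : ℝ} {g : H → H}
    (hg : IsMonotoneField γ R g) : ∃ K, LipschitzOnWith K (fderiv ℝ g) (ball 0 R) := by
  have h : ContDiff ℝ 1 (fderiv ℝ g) := hg.contDiff.fderiv_right (by norm_num)
  obtain ⟨K, hK⟩ := (h.contDiffOn (s := closedBall 0 R)).exists_lipschitzOnWith
    one_ne_zero (convex_closedBall 0 R) (isCompact_closedBall 0 R)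
  exact ⟨K, hK.mono ball_subset_closedBall⟩

theorem IsMonotoneField.exists_solution {γ R : ℝ} {g : H → H} (hγ : 0 < γ)
    (hg : IsMonotoneField γ R g) {x : H} (hx : x ∈ ball (0 : H) R) :
    ∃ α : ℝ → H, α 0 = x ∧ ∀ t, 0 ≤ t →
      α t ∈ ball (0 : H) R ∧ HasDerivWithinAt α (-(g (α t))) (Ici 0) t := by
  have hx' : ‖x‖ < R := by simpa using hx
  have hR : 0 < R := (norm_nonneg x).trans_lt hx'
  refine exists_global_solution (v := fun _ y => -(g y)) (fun n => ?_) (fun n => ?_)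
  · obtain ⟨K, hK⟩ := hg.exists_lipschitzOnWith
    exact ⟨K, fun t _ => hK.neg⟩
  -- The cutoff makes the field globally Lipschitz and bounded, and it vanishes outside the ball
  -- where monotonicity is unknown. Hence `‖α‖` is nonincreasing, the path stays within radius
  -- `‖x‖`, and there the cutoff equals `1`.
  let χ : ContDiffBump (0 : H) := ⟨(‖x‖ + R) / 2, R, by positivity, by linarith⟩
  have hs : ContDiff ℝ 2 (fun y => -(χ y • g y)) := (χ.contDiff.smul hg.contDiff).neg
  have hc : HasCompactSupport (fun y => -(χ y • g y)) := χ.hasCompactSupport.smul_right.neg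
  obtain ⟨K, hK⟩ := hs.lipschitzWith_of_hasCompactSupport hc two_ne_zero
  obtain ⟨L, hL⟩ := hc.exists_bound_of_continuous hs.continuous
  obtain ⟨α, h0, hα⟩ := exists_solution_of_bounded (v := fun _ y => -(χ y • g y)) (L := L.toNNReal)
    (Nat.cast_nonneg n) (fun _ _ => hK) (fun _ => continuousOn_const)
    (fun _ _ y => (hL y).trans (Real.le_coe_toNNReal L)) x
  have hsign : ∀ y, 0 ≤ χ y * inner ℝ (g y) y := by
    intro y
    by_cases hy : y ∈ ball (0 : H) R
    · have := hg.mono y hy 0 (mem_ball_self hR)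
      rw [hg.zero, sub_zero, sub_zero] at this
      exact mul_nonneg χ.nonneg ((by positivity : 0 ≤ γ * ‖y‖ ^ 2).trans this)
    · rw [χ.zero_of_le_dist (by simpa using hy), zero_mul]
  have hanti : AntitoneOn (fun t => ‖α t‖ ^ 2) (Icc (0 : ℝ) n) := by
    have hd : ∀ t ∈ interior (Icc (0 : ℝ) n),
        HasDerivAt (fun t => ‖α t‖ ^ 2) (2 * inner ℝ (α t) (-(χ (α t) • g (α t)))) t := fun t ht =>
      ((hα t (interior_subset ht)).hasDerivAt (mem_interior_iff_mem_nhds.1 ht)).norm_sq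
    refine antitoneOn_of_deriv_nonpos (convex_Icc _ _)
      (fun t ht => (hα t ht).norm_sq.continuousWithinAt)
      (fun t ht => (hd t ht).differentiableAt.differentiableWithinAt) fun t ht => ?_
    rw [(hd t ht).deriv, inner_neg_right, inner_smul_right, real_inner_comm]
    linarith [hsign (α t)]
  have hle : ∀ t ∈ Icc (0 : ℝ) n, ‖α t‖ ≤ ‖x‖ := fun t ht => by
    have := hanti (left_mem_Icc.2 (Nat.cast_nonneg n)) ht ht.1
    simp only [h0] at this
    exact (pow_le_pow_iff_left₀ (norm_nonneg _) (norm_nonneg _) two_ne_zero).1 this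
  refine ⟨α, h0, fun t ht => ⟨?_, ?_⟩⟩
  · rw [mem_ball_zero_iff]
    exact (hle t ht).trans_lt hx'
  · have h1 : χ (α t) = 1 := by
      refine χ.one_of_mem_closedBall ?_
      rw [mem_closedBall_zero_iff]
      exact (hle t ht).trans (show ‖x‖ ≤ (‖x‖ + R) / 2 by linarith)
    simpa only [h1, one_smul] using hα t ht

theorem IsMonotoneField.exists_flow {γ R : ℝ} {g : H → H} (hγ : 0 < γ) (hg : IsMonotoneField γ R g) :
    ∃ X, IsFlow R g X := by
  classical
  choose α h0 hα using fun x : ball (0 : H) R => hg.exists_solution hγ x.2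
  refine ⟨fun t x => if hx : x ∈ ball (0 : H) R then α ⟨x, hx⟩ t else 0, ?_, ?_, ?_⟩
  · intro x hx
    simp only [hx, dite_true]
    exact h0 ⟨x, hx⟩
  · intro x hx t ht
    simp only [hx, dite_true]
    exact (hα ⟨x, hx⟩ t ht).1
  · intro x hx t ht
    simp only [hx, dite_true]
    exact (hα ⟨x, hx⟩ t ht).2

end FiniteDimensional

namespace IsFlow

variable {γ R : ℝ} {g : H → H} {X : ℝ → H → H}

theorem norm_sub_le (hX : IsFlow R g X) (hg : IsMonotoneField γ R g) {x y : H} (hx : x ∈ ball 0 R)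
    (hy : y ∈ ball 0 R) {t : ℝ} (ht : 0 ≤ t) :
    ‖X t x - X t y‖ ≤ Real.exp (-γ * t) * ‖x - y‖ := by
  have := norm_sub_le_of_solutions hg (fun t ht => ⟨hX.mem x hx t ht, hX.deriv x hx t ht⟩)
    (fun t ht => ⟨hX.mem y hy t ht, hX.deriv y hy t ht⟩) ht
  rwa [hX.init x hx, hX.init y hy] at this

theorem eq_of_solution (hX : IsFlow R g X) (hg : IsMonotoneField γ R g) {α : ℝ → H}
    (hα : ∀ t, 0 ≤ t → α t ∈ ball (0 : H) R ∧ HasDerivWithinAt α (-(g (α t))) (Ici 0) t)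
    {t : ℝ} (ht : 0 ≤ t) : X t (α 0) = α t := by
  have h0 := (hα 0 le_rfl).1
  have := norm_sub_le_of_solutions hg
    (fun t ht => ⟨hX.mem _ h0 t ht, hX.deriv _ h0 t ht⟩) hα ht
  rw [hX.init _ h0, sub_self, norm_zero, mul_zero] at this
  exact sub_eq_zero.1 (norm_le_zero_iff.1 this)

theorem zero (hX : IsFlow R g X) (hg : IsMonotoneField γ R g) (hR : 0 < R) {t : ℝ} (ht : 0 ≤ t) :
    X t 0 = 0 :=
  hX.eq_of_solution hg (α := fun _ => 0) (fun t _ => ⟨mem_ball_self hR, by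
    rw [hg.zero, neg_zero]; exact hasDerivWithinAt_const _ _ _⟩) ht

theorem norm_le (hX : IsFlow R g X) (hg : IsMonotoneField γ R g) {x : H} (hx : x ∈ ball 0 R)
    {t : ℝ} (ht : 0 ≤ t) : ‖X t x‖ ≤ Real.exp (-γ * t) * ‖x‖ := by
  have hR : 0 < R := pos_of_mem_ball hx
  simpa [hX.zero hg hR ht] using hX.norm_sub_le hg hx (mem_ball_self hR) ht

theorem add (hX : IsFlow R g X) (hg : IsMonotoneField γ R g) {x : H} (hx : x ∈ ball 0 R)
    {s t : ℝ} (hs : 0 ≤ s) (ht : 0 ≤ t) : X (t + s) x = X t (X s x) := by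
  have := hX.eq_of_solution hg (α := fun t => X (t + s) x) (fun t ht => ⟨hX.mem x hx _ (by positivity), ?_⟩) ht
  · simpa using this.symm
  · have h1 := hX.deriv x hx (t + s) (by positivity)
    have h2 : HasDerivWithinAt (fun t : ℝ => t + s) 1 (Ici 0) t :=
      ((hasDerivAt_id t).add_const s).hasDerivWithinAt
    have h3 := h1.scomp t h2 (fun r (hr : 0 ≤ r) => by show 0 ≤ r + s; positivity)
    simpa [Function.comp_def] using h3

theorem continuousOn_time (hX : IsFlow R g X) {x : H} (hx : x ∈ ball 0 R) :
    ContinuousOn (fun t => X t x) (Ici 0) := fun t ht => (hX.deriv x hx t ht).continuousWithinAt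

/-- Continuity in time for each point together with a Lipschitz constant in space that is uniform in
time gives joint continuity. -/
theorem continuous (hX : IsFlow R g X) (hg : IsMonotoneField γ R g) (hγ : 0 < γ) :
    Continuous fun p : ℝ≥0 × ball (0 : H) R => X p.1 p.2 := by
  refine continuous_prod_of_continuous_lipschitzWith' _ 1 (fun t => ?_) fun x => ?_
  · refine LipschitzWith.of_dist_le_mul fun x y => ?_
    rw [dist_eq_norm, NNReal.coe_one, one_mul, Subtype.dist_eq, dist_eq_norm]
    refine (hX.norm_sub_le hg x.2 y.2 t.coe_nonneg).trans (mul_le_of_le_one_left (norm_nonneg _) ?_)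
    rw [Real.exp_le_one_iff]
    have : 0 ≤ (t : ℝ) := t.coe_nonneg
    linarith [mul_nonneg hγ.le this]
  · exact (hX.continuousOn_time x.2).comp_continuous NNReal.continuous_coe fun t => t.coe_nonneg

end IsFlow

end Flow

theorem hasFDerivAt_of_norm_sub_le_sq {V W : Type*} [NormedAddCommGroup V] [NormedSpace ℝ V]
    [NormedAddCommGroup W] [NormedSpace ℝ W] {F : V → W} {L : V →L[ℝ] W} {x : V} {C : ℝ}
    (h : ∀ᶠ y in 𝓝 x, ‖F y - F x - L (y - x)‖ ≤ C * ‖y - x‖ ^ 2) : HasFDerivAt F L x := by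
  refine HasFDerivAt.of_isLittleO ?_
  refine (Asymptotics.IsBigO.of_bound C (g := fun y => ‖y - x‖ ^ 2) ?_).trans_isLittleO
    (Asymptotics.isLittleO_pow_sub_sub x one_lt_two)
  filter_upwards [h] with y hy
  simpa using hy

/-! ### First and second spatial derivatives of the flow. -/

section FlowDerivative

variable {H : Type*} [NormedAddCommGroup H] [InnerProductSpace ℝ H] [FiniteDimensional ℝ H]
variable {γ R : ℝ} {g : H → H} {X : ℝ → H → H}

theorem IsMonotoneField.norm_sub_sub_fderiv_le (hg : IsMonotoneField γ R g) {K : ℝ≥0}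
    (hK : LipschitzOnWith K (fderiv ℝ g) (ball 0 R)) {x y : H} (hx : x ∈ ball 0 R)
    (hy : y ∈ ball 0 R) : ‖g y - g x - fderiv ℝ g x (y - x)‖ ≤ K * ‖y - x‖ ^ 2 := by
  have hseg : segment ℝ x y ⊆ ball 0 R := (convex_ball 0 R).segment_subset hx hy
  have := (convex_segment x y).norm_image_sub_le_of_norm_fderiv_le' (f := g) (φ := fderiv ℝ g x)
    (C := K * ‖y - x‖) (fun z _ => (hg.contDiff.differentiable two_ne_zero) z) (fun z hz => ?_)
    (left_mem_segment ℝ x y) (right_mem_segment ℝ x y)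
  · rw [sq, ← mul_assoc]; exact this
  · refine (hK.norm_sub_le (hseg hz) hx).trans ?_
    gcongr
    simpa [norm_sub_rev] using norm_sub_le_of_mem_segment hz

namespace IsFlow

theorem continuousOn_fderiv_comp (hX : IsFlow R g X) (hg : IsMonotoneField γ R g) {x : H}
    (hx : x ∈ ball 0 R) : ContinuousOn (fun t => fderiv ℝ g (X t x)) (Ici 0) :=
  (hg.contDiff.continuous_fderiv two_ne_zero).comp_continuousOn (hX.continuousOn_time hx)

/-- `Y` solves the linearized equation and `W` the adjoint one, so `W * Y` has zero derivative and
stays `1`. In finite dimension the left inverse is also a right inverse. -/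
theorem exists_fundamental_solution (hX : IsFlow R g X) (hg : IsMonotoneField γ R g) {x : H}
    (hx : x ∈ ball 0 R) : ∃ Y W : ℝ → H →L[ℝ] H, Y 0 = 1 ∧ W 0 = 1 ∧
      (∀ t, 0 ≤ t → HasDerivWithinAt Y (-(fderiv ℝ g (X t x) * Y t)) (Ici 0) t) ∧
      (∀ t, 0 ≤ t → HasDerivWithinAt W (W t * fderiv ℝ g (X t x)) (Ici 0) t) ∧
      (∀ t, 0 ≤ t → W t * Y t = 1) ∧ ∀ t, 0 ≤ t → Y t * W t = 1 := by
  have hA := hX.continuousOn_fderiv_comp hg hx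
  obtain ⟨Y, hY0, hY⟩ := exists_linear_solution
    (A := fun t => -(ContinuousLinearMap.mul ℝ (H →L[ℝ] H) (fderiv ℝ g (X t x))))
    ((ContinuousLinearMap.continuous _).comp_continuousOn hA).neg (1 : H →L[ℝ] H)
  obtain ⟨W, hW0, hW⟩ := exists_linear_solution
    (A := fun t => (ContinuousLinearMap.mul ℝ (H →L[ℝ] H)).flip (fderiv ℝ g (X t x)))
    ((ContinuousLinearMap.continuous _).comp_continuousOn hA) (1 : H →L[ℝ] H)
  replace hY : ∀ t, 0 ≤ t → HasDerivWithinAt Y (-(fderiv ℝ g (X t x) * Y t)) (Ici 0) t :=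
    fun t ht => by simpa using hY t ht
  replace hW : ∀ t, 0 ≤ t → HasDerivWithinAt W (W t * fderiv ℝ g (X t x)) (Ici 0) t :=
    fun t ht => by simpa using hW t ht
  have hWY : ∀ t, 0 ≤ t → W t * Y t = 1 := by
    intro t ht
    have hd : ∀ s, 0 ≤ s → HasDerivWithinAt (fun s => W s * Y s) 0 (Ici 0) s := fun s hs => by
      have := (hW s hs).mul (hY s hs)
      rwa [mul_neg, mul_assoc, add_neg_cancel] at this
    have := constant_of_has_deriv_right_zero (f := fun s => W s * Y s) (a := 0) (b := t)
      (fun s hs => ((hd s hs.1).continuousWithinAt).mono fun r hr => hr.1)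
      (fun s hs => (hd s hs.1).mono (Ici_subset_Ici.2 hs.1)) t (right_mem_Icc.2 ht)
    rw [this, hY0, hW0, one_mul]
  refine ⟨Y, W, hY0, hW0, hY, hW, hWY, fun t ht => ?_⟩
  have h1 := congrArg ContinuousLinearMap.toLinearMap (hWY t ht)
  have h2 : (W t : H →ₗ[ℝ] H) * (Y t : H →ₗ[ℝ] H) = 1 := h1
  have h3 := mul_eq_one_comm.1 h2
  ext v
  exact LinearMap.congr_fun h3 v

/-- The derivative of `W s (X s y - X s x)` contains only the Taylor remainder of `g`, because `W`
cancels the linear part. The remainder is quadratic in `‖y - x‖`, since the flow does not expand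
distances; applying `Y t = (W t)⁻¹` gives the expansion of `X t`. -/
theorem hasFDerivAt_of_fundamental_solution (hX : IsFlow R g X) (hg : IsMonotoneField γ R g)
    (hγ : 0 < γ) {x : H} (hx : x ∈ ball 0 R) {Y W : ℝ → H →L[ℝ] H} (hW0 : W 0 = 1)
    (hW : ∀ t, 0 ≤ t → HasDerivWithinAt W (W t * fderiv ℝ g (X t x)) (Ici 0) t)
    (hYW : ∀ t, 0 ≤ t → Y t * W t = 1) {t : ℝ} (ht : 0 ≤ t) : HasFDerivAt (X t) (Y t) x := by
  obtain ⟨K, hK⟩ := hg.exists_lipschitzOnWith_fderiv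
  have hWc : ContinuousOn W (Icc 0 t) := fun s hs =>
    (hW s hs.1).continuousWithinAt.mono fun r hr => hr.1
  obtain ⟨C, hC⟩ := isCompact_Icc.exists_bound_of_continuousOn hWc
  have hC0 : 0 ≤ C := (norm_nonneg _).trans (hC 0 (left_mem_Icc.2 ht))
  refine hasFDerivAt_of_norm_sub_le_sq (C := ‖Y t‖ * (C * K * t)) ?_
  filter_upwards [isOpen_ball.mem_nhds hx] with y hy
  have hd : ∀ s, 0 ≤ s → HasDerivWithinAt (fun s => W s (X s y - X s x))
      (W s (fderiv ℝ g (X s x) (X s y - X s x) - (g (X s y) - g (X s x)))) (Ici 0) s := fun s hs => by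
    have := (hW s hs).clm_apply ((hX.deriv y hy s hs).sub (hX.deriv x hx s hs))
    refine this.congr_deriv ?_
    simp only [mul_apply_eq_comp, Pi.sub_apply, map_sub, map_neg]
    abel
  have hb := norm_image_sub_le_of_norm_deriv_right_le_segment
    (f := fun s => W s (X s y - X s x)) (a := 0) (b := t) (C := C * (K * ‖y - x‖ ^ 2))
    (fun s hs => (hd s hs.1).continuousWithinAt.mono fun r hr => hr.1)
    (fun s hs => (hd s hs.1).mono (Ici_subset_Ici.2 hs.1)) (fun s hs => ?_) t (right_mem_Icc.2 ht)
  · simp only [hX.init x hx, hX.init y hy, hW0, one_apply_eq_self, sub_zero] at hb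
    have e : X t y - X t x - Y t (y - x) = Y t (W t (X t y - X t x) - (y - x)) := by
      have h1 : Y t (W t (X t y - X t x)) = X t y - X t x := DFunLike.congr_fun (hYW t ht) _
      rw [map_sub (Y t) (W t _), h1]
    rw [e]
    calc _ ≤ ‖Y t‖ * ‖W t (X t y - X t x) - (y - x)‖ := (Y t).le_opNorm _
      _ ≤ ‖Y t‖ * (C * (K * ‖y - x‖ ^ 2) * t) := by gcongr
      _ = _ := by ring
  · refine ((W s).le_opNorm _).trans ?_
    have h1 : ‖X s y - X s x‖ ≤ ‖y - x‖ := by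
      refine (hX.norm_sub_le hg hy hx hs.1).trans (mul_le_of_le_one_left (norm_nonneg _) ?_)
      rw [Real.exp_le_one_iff]
      linarith [mul_nonneg hγ.le hs.1]
    have h2 := hg.norm_sub_sub_fderiv_le hK (hX.mem x hx s hs.1) (hX.mem y hy s hs.1)
    rw [norm_sub_rev] at h2
    refine mul_le_mul (hC s ⟨hs.1, hs.2.le⟩) (h2.trans ?_) (norm_nonneg _) hC0
    gcongr

theorem differentiableAt (hX : IsFlow R g X) (hg : IsMonotoneField γ R g) (hγ : 0 < γ) {x : H}
    (hx : x ∈ ball 0 R) {t : ℝ} (ht : 0 ≤ t) : DifferentiableAt ℝ (X t) x := by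
  obtain ⟨Y, W, hY0, hW0, hY, hW, hWY, hYW⟩ := hX.exists_fundamental_solution hg hx
  exact (hX.hasFDerivAt_of_fundamental_solution hg hγ hx hW0 hW hYW ht).differentiableAt

theorem exists_inverse (hX : IsFlow R g X) (hg : IsMonotoneField γ R g) (hγ : 0 < γ) {x : H}
    (hx : x ∈ ball 0 R) : ∃ W : ℝ → H →L[ℝ] H, W 0 = 1 ∧
      (∀ t, 0 ≤ t → HasDerivWithinAt (fun t => fderiv ℝ (X t) x)
        (-(fderiv ℝ g (X t x) * fderiv ℝ (X t) x)) (Ici 0) t) ∧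
      (∀ t, 0 ≤ t → HasDerivWithinAt W (W t * fderiv ℝ g (X t x)) (Ici 0) t) ∧
      (∀ t, 0 ≤ t → W t * fderiv ℝ (X t) x = 1) ∧ ∀ t, 0 ≤ t → fderiv ℝ (X t) x * W t = 1 := by
  obtain ⟨Y, W, hY0, hW0, hY, hW, hWY, hYW⟩ := hX.exists_fundamental_solution hg hx
  have h : ∀ t, 0 ≤ t → fderiv ℝ (X t) x = Y t := fun t ht =>
    (hX.hasFDerivAt_of_fundamental_solution hg hγ hx hW0 hW hYW ht).fderiv
  refine ⟨W, hW0, fun t ht => ?_, hW, fun t ht => ?_, fun t ht => ?_⟩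
  · rw [h t ht]
    exact (hY t ht).congr (fun s hs => h s hs) (h t ht)
  · rw [h t ht, hWY t ht]
  · rw [h t ht, hYW t ht]

theorem norm_fderiv_le (hX : IsFlow R g X) (hg : IsMonotoneField γ R g) {x : H}
    (hx : x ∈ ball 0 R) {t : ℝ} (ht : 0 ≤ t) : ‖fderiv ℝ (X t) x‖ ≤ Real.exp (-γ * t) := by
  have h := norm_fderiv_le_of_lipschitzOn ℝ (f := X t) (C := (Real.exp (-γ * t)).toNNReal)
    (isOpen_ball.mem_nhds hx) (LipschitzOnWith.of_dist_le_mul fun y hy z hz => by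
      rw [dist_eq_norm, dist_eq_norm, Real.coe_toNNReal _ (Real.exp_pos _).le]
      exact hX.norm_sub_le hg hy hz ht)
  rwa [Real.coe_toNNReal _ (Real.exp_pos _).le] at h

theorem fderiv_zero (hX : IsFlow R g X) {x : H} (hx : x ∈ ball 0 R) : fderiv ℝ (X 0) x = 1 := by
  have : X 0 =ᶠ[𝓝 x] id := by
    filter_upwards [isOpen_ball.mem_nhds hx] with y hy using hX.init y hy
  rw [this.fderiv_eq, fderiv_id]
  rfl

theorem fderiv_add (hX : IsFlow R g X) (hg : IsMonotoneField γ R g) (hγ : 0 < γ) {x : H}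
    (hx : x ∈ ball 0 R) {s t : ℝ} (hs : 0 ≤ s) (ht : 0 ≤ t) :
    fderiv ℝ (X (t + s)) x = fderiv ℝ (X t) (X s x) * fderiv ℝ (X s) x := by
  have : X (t + s) =ᶠ[𝓝 x] X t ∘ X s := by
    filter_upwards [isOpen_ball.mem_nhds hx] with y hy using hX.add hg hy hs ht
  rw [this.fderiv_eq, fderiv_comp _ (hX.differentiableAt hg hγ (hX.mem x hx s hs) ht)
    (hX.differentiableAt hg hγ hx hs)]
  rfl

/-- Variation of constants: integrate the derivative of `DX_t(x) * W s * DX_s(y)` from `0` to `t`,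
where `W s` inverts `DX_s(x)`. The chain rule identifies `DX_t(x) * W s` with `DX_{t-s}(X_s x)`,
which removes the uncontrolled inverse. -/
theorem fderiv_sub_fderiv (hX : IsFlow R g X) (hg : IsMonotoneField γ R g) (hγ : 0 < γ) {x y : H}
    (hx : x ∈ ball 0 R) (hy : y ∈ ball 0 R) {t : ℝ} (ht : 0 ≤ t) :
    fderiv ℝ (X t) y - fderiv ℝ (X t) x = ∫ s in (0 : ℝ)..t, fderiv ℝ (X (t - s)) (X s x) *
      (fderiv ℝ g (X s x) - fderiv ℝ g (X s y)) * fderiv ℝ (X s) y := by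
  have : CompleteSpace H := FiniteDimensional.complete ℝ H
  obtain ⟨W, hW0, hYx, hW, hWY, hYW⟩ := hX.exists_inverse hg hγ hx
  obtain ⟨-, -, hYy, -⟩ := hX.exists_inverse hg hγ hy
  have hd : ∀ s, 0 ≤ s → HasDerivWithinAt (fun s => fderiv ℝ (X t) x * (W s * fderiv ℝ (X s) y))
      (fderiv ℝ (X t) x * W s * (fderiv ℝ g (X s x) - fderiv ℝ g (X s y)) * fderiv ℝ (X s) y)
      (Ici 0) s := fun s hs => by
    refine (((hW s hs).mul (hYy s hs)).const_mul (fderiv ℝ (X t) x)).congr_deriv ?_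
    noncomm_ring
  have hc : ContinuousOn (fun s => fderiv ℝ (X t) x * W s *
      (fderiv ℝ g (X s x) - fderiv ℝ g (X s y)) * fderiv ℝ (X s) y) (Icc 0 t) :=
    (((continuousOn_const.mul fun s hs => (hW s hs).continuousWithinAt).mul
      ((hX.continuousOn_fderiv_comp hg hx).sub (hX.continuousOn_fderiv_comp hg hy))).mul
      fun s hs => (hYy s hs).continuousWithinAt).mono fun s hs => hs.1
  have key := intervalIntegral.integral_eq_sub_of_hasDeriv_right (a := 0) (b := t)
    (f := fun s => fderiv ℝ (X t) x * (W s * fderiv ℝ (X s) y))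
    (f' := fun s => fderiv ℝ (X t) x * W s * (fderiv ℝ g (X s x) - fderiv ℝ g (X s y)) *
      fderiv ℝ (X s) y)
    (fun s hs => by
      rw [uIcc_of_le ht] at hs ⊢
      exact (hd s hs.1).continuousWithinAt.mono fun r hr => hr.1)
    (fun s hs => by
      rw [min_eq_left ht, max_eq_right ht] at hs
      exact (hd s hs.1.le).mono fun r (hr : s < r) => hs.1.le.trans hr.le)
    (by rw [← uIcc_of_le ht] at hc; exact hc.intervalIntegrable)
  rw [← mul_assoc, hYW t ht, one_mul, hW0, hX.fderiv_zero hy, one_mul, mul_one] at key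
  rw [← key]
  refine intervalIntegral.integral_congr fun s hs => ?_
  rw [uIcc_of_le ht] at hs
  have h1 := hX.fderiv_add hg hγ hx hs.1 (sub_nonneg.2 hs.2)
  rw [sub_add_cancel] at h1
  change _ = fderiv ℝ (X (t - s)) (X s x) * _ * _
  rw [h1, mul_assoc _ _ (W s), hYW s hs.1, mul_one]

theorem exists_lipschitz_fderiv (hX : IsFlow R g X) (hg : IsMonotoneField γ R g) (hγ : 0 < γ) :
    ∃ C : ℝ≥0, ∀ t, 0 ≤ t → LipschitzOnWith C (fun x => fderiv ℝ (X t) x) (ball 0 R) := by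
  obtain ⟨K, hK⟩ := hg.exists_lipschitzOnWith_fderiv
  refine ⟨K * (1 / γ).toNNReal, fun t ht => LipschitzOnWith.of_dist_le_mul fun y hy x hx => ?_⟩
  rw [dist_eq_norm, dist_eq_norm, hX.fderiv_sub_fderiv hg hγ hx hy ht]
  have hb := intervalIntegral.norm_integral_le_of_norm_le_const (a := 0) (b := t)
    (C := Real.exp (-γ * t) * K * ‖y - x‖)
    (f := fun s => fderiv ℝ (X (t - s)) (X s x) *
      (fderiv ℝ g (X s x) - fderiv ℝ g (X s y)) * fderiv ℝ (X s) y) (fun s hs => ?_)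
  · refine hb.trans ?_
    rw [sub_zero, abs_of_nonneg ht, NNReal.coe_mul, Real.coe_toNNReal _ (by positivity)]
    -- The integrand is bounded by `K e^{-γt}‖y - x‖` for every `s`, so the integral produces `t
    -- e^{-γt}`; this bound makes the Lipschitz constant independent of `t`.
    have h1 : Real.exp (-γ * t) * t ≤ 1 / γ := by
      rw [le_div_iff₀ hγ, neg_mul, Real.exp_neg, mul_assoc, inv_mul_le_iff₀ (Real.exp_pos _), mul_one]
      have := Real.add_one_le_exp (γ * t)
      linarith
    calc _ = K * (Real.exp (-γ * t) * t) * ‖y - x‖ := by ring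
      _ ≤ _ := by gcongr
  · rw [uIoc_of_le ht] at hs
    have hs0 := hs.1.le
    have h1 := hX.norm_fderiv_le hg (hX.mem x hx s hs0) (sub_nonneg.2 hs.2)
    have h2 := hK.norm_sub_le (hX.mem x hx s hs0) (hX.mem y hy s hs0)
    have h3 := hX.norm_sub_le hg hx hy hs0
    have h4 : ‖fderiv ℝ (X s) y‖ ≤ 1 := (hX.norm_fderiv_le hg hy hs0).trans (by
      rw [Real.exp_le_one_iff]
      linarith [mul_nonneg hγ.le hs0])
    have h5 : Real.exp (-γ * (t - s)) * Real.exp (-γ * s) = Real.exp (-γ * t) := by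
      rw [← Real.exp_add]; ring_nf
    calc _ ≤ ‖fderiv ℝ (X (t - s)) (X s x)‖ * ‖fderiv ℝ g (X s x) - fderiv ℝ g (X s y)‖ *
          ‖fderiv ℝ (X s) y‖ := (norm_mul_le _ _).trans (by gcongr; exact norm_mul_le _ _)
      _ ≤ Real.exp (-γ * (t - s)) * (K * (Real.exp (-γ * s) * ‖x - y‖)) * 1 := by
          gcongr
          exact h2.trans (by gcongr)
      _ = _ := by rw [← h5, norm_sub_rev]; ring

theorem continuousOn_fderiv_time (hX : IsFlow R g X) (hg : IsMonotoneField γ R g) (hγ : 0 < γ)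
    {x : H} (hx : x ∈ ball 0 R) : ContinuousOn (fun t => fderiv ℝ (X t) x) (Ici 0) := by
  obtain ⟨-, -, h, -⟩ := hX.exists_inverse hg hγ hx
  exact fun t ht => (h t ht).continuousWithinAt

theorem continuous_fderiv (hX : IsFlow R g X) (hg : IsMonotoneField γ R g) (hγ : 0 < γ) :
    Continuous fun p : ℝ≥0 × ball (0 : H) R => fderiv ℝ (X p.1) p.2 := by
  obtain ⟨C, hC⟩ := hX.exists_lipschitz_fderiv hg hγ
  refine continuous_prod_of_continuous_lipschitzWith' _ C (fun t => ?_) fun x => ?_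
  · exact (lipschitzOnWith_iff_restrict.1 (hC t t.coe_nonneg))
  · exact (hX.continuousOn_fderiv_time hg hγ x.2).comp_continuous NNReal.continuous_coe fun t => t.coe_nonneg

end IsFlow

/-- The linear map `h ↦ -P ∘ D (Q h) ∘ Q`. -/
noncomputable def sandwich (P : H →L[ℝ] H) (D : H →L[ℝ] H →L[ℝ] H) (Q : H →L[ℝ] H) :
    H →L[ℝ] H →L[ℝ] H :=
  -((ContinuousLinearMap.compL ℝ H H H P ∘L
    ((ContinuousLinearMap.compL ℝ H H H).flip Q ∘L (D ∘L Q))))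

namespace IsFlow

theorem continuousOn_fderiv_comp_sub (hX : IsFlow R g X) (hg : IsMonotoneField γ R g) (hγ : 0 < γ)
    {x : H} (hx : x ∈ ball 0 R) {t : ℝ} :
    ContinuousOn (fun s => fderiv ℝ (X (t - s)) (X s x)) (Icc 0 t) := by
  have hXc : ContinuousOn (fun s => X s x) (Icc 0 t) :=
    (hX.continuousOn_time hx).mono fun s hs => hs.1
  rw [continuousOn_iff_continuous_domRestrict]
  have := (hX.continuous_fderiv hg hγ).comp (f := fun s : Icc 0 t =>
    ((⟨t - s, sub_nonneg.2 s.2.2⟩ : ℝ≥0), (⟨X s x, hX.mem x hx s s.2.1⟩ : ball (0 : H) R)))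
    (((continuous_const.sub continuous_subtype_val).subtype_mk _).prodMk
      ((continuousOn_iff_continuous_domRestrict.1 hXc).subtype_mk _))
  exact this

theorem continuousOn_sandwich (hX : IsFlow R g X) (hg : IsMonotoneField γ R g) (hγ : 0 < γ) {x : H}
    (hx : x ∈ ball 0 R) {t : ℝ} : ContinuousOn (fun s => sandwich (fderiv ℝ (X (t - s)) (X s x))
      (fderiv ℝ (fderiv ℝ g) (X s x)) (fderiv ℝ (X s) x)) (Icc 0 t) := by
  have h1 : ContDiff ℝ 1 (fderiv ℝ g) := hg.contDiff.fderiv_right (by norm_num)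
  have hXc : ContinuousOn (fun s => X s x) (Icc 0 t) :=
    (hX.continuousOn_time hx).mono fun s hs => hs.1
  have hQ : ContinuousOn (fun s => fderiv ℝ (X s) x) (Icc 0 t) :=
    (hX.continuousOn_fderiv_time hg hγ hx).mono fun s hs => hs.1
  have hD : ContinuousOn (fun s => fderiv ℝ (fderiv ℝ g) (X s x)) (Icc 0 t) :=
    (h1.continuous_fderiv one_ne_zero).comp_continuousOn hXc
  have hP := hX.continuousOn_fderiv_comp_sub hg hγ hx (t := t)
  exact ((((ContinuousLinearMap.continuous _).comp_continuousOn hP).clm_comp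
    (((ContinuousLinearMap.continuous _).comp_continuousOn hQ).clm_comp (hD.clm_comp hQ)))).neg

/-- Differentiates `fderiv_sub_fderiv` in `y` at `y = x`. The result involves only `DX` and `D²g`,
so it can be iterated to reach higher derivatives. -/
theorem hasFDerivAt_fderiv (hX : IsFlow R g X) (hg : IsMonotoneField γ R g) (hγ : 0 < γ) {x : H}
    (hx : x ∈ ball 0 R) {t : ℝ} (ht : 0 ≤ t) :
    HasFDerivAt (fun y => fderiv ℝ (X t) y) (∫ s in (0 : ℝ)..t,
      sandwich (fderiv ℝ (X (t - s)) (X s x)) (fderiv ℝ (fderiv ℝ g) (X s x)) (fderiv ℝ (X s) x))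
      x := by
  have : CompleteSpace H := FiniteDimensional.complete ℝ H
  obtain ⟨K, hK⟩ := hg.exists_lipschitzOnWith_fderiv
  obtain ⟨C, hC⟩ := hX.exists_lipschitz_fderiv hg hγ
  have hXc : ∀ y ∈ ball (0 : H) R, ContinuousOn (fun s => fderiv ℝ g (X s y)) (Icc 0 t) :=
    fun y hy => (hX.continuousOn_fderiv_comp hg hy).mono fun s hs => hs.1
  have hQ : ∀ y ∈ ball (0 : H) R, ContinuousOn (fun s => fderiv ℝ (X s) y) (Icc 0 t) :=
    fun y hy => (hX.continuousOn_fderiv_time hg hγ hy).mono fun s hs => hs.1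
  have hP := hX.continuousOn_fderiv_comp_sub hg hγ hx (t := t)
  set F : H → ℝ → H →L[ℝ] H := fun y s => fderiv ℝ (X (t - s)) (X s x) *
      (fderiv ℝ g (X s x) - fderiv ℝ g (X s y)) * fderiv ℝ (X s) y with hF
  have hFc : ∀ y ∈ ball (0 : H) R, ContinuousOn (F y) (Icc 0 t) := fun y hy =>
    (hP.mul ((hXc x hx).sub (hXc y hy))).mul (hQ y hy)
  have hmeas : ∀ {V : Type _} [NormedAddCommGroup V] [NormedSpace ℝ V] {φ : ℝ → V},
      ContinuousOn φ (Icc 0 t) → IntegrableOn φ (Ioc 0 t) := fun h =>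
    (h.integrableOn_Icc).mono_set Ioc_subset_Icc_self
  have hF0 : F x = fun _ => 0 := by ext1 s; simp [hF]
  have hle1 : ∀ s, 0 ≤ s → Real.exp (-γ * s) ≤ 1 := fun s hs => by
    rw [Real.exp_le_one_iff]
    linarith [mul_nonneg hγ.le hs]
  have hAle : ∀ s ∈ Ioc 0 t, ∀ y ∈ ball (0 : H) R,
      ‖fderiv ℝ (X (t - s)) (X s x) * (fderiv ℝ g (X s x) - fderiv ℝ g (X s y))‖ ≤
        K * ‖y - x‖ := fun s hs y hy => by
    have h1 := (hX.norm_fderiv_le hg (hX.mem x hx s hs.1.le) (sub_nonneg.2 hs.2)).trans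
      (hle1 _ (sub_nonneg.2 hs.2))
    have h2 := hK.norm_sub_le (hX.mem x hx s hs.1.le) (hX.mem y hy s hs.1.le)
    have h3 := (hX.norm_sub_le hg hx hy hs.1.le).trans
      (mul_le_of_le_one_left (norm_nonneg _) (hle1 _ hs.1.le))
    rw [norm_sub_rev y x]
    calc _ ≤ _ := norm_mul_le _ _
      _ ≤ 1 * (K * ‖x - y‖) := mul_le_mul h1 (h2.trans (by gcongr)) (norm_nonneg _) zero_le_one
      _ = _ := one_mul _
  have key := (hasFDerivAt_integral_of_dominated_loc_of_lip' (𝕜 := ℝ) (F := F)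
    (μ := volume.restrict (Ioc 0 t)) (x₀ := x) (s := ball 0 R) (bound := fun _ => (K : ℝ))
    (F' := fun s => sandwich (fderiv ℝ (X (t - s)) (X s x)) (fderiv ℝ (fderiv ℝ g) (X s x))
      (fderiv ℝ (X s) x)) (isOpen_ball.mem_nhds hx)
    (fun y hy => (hmeas (hFc y hy)).aestronglyMeasurable) (hmeas (hFc x hx))
    (hmeas (hX.continuousOn_sandwich hg hγ hx)).aestronglyMeasurable
    (by
      refine (ae_restrict_iff' measurableSet_Ioc).2 (ae_of_all _ fun s hs y hy => ?_)
      rw [hF0, sub_zero]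
      have h4 := (hX.norm_fderiv_le hg hy hs.1.le).trans (hle1 _ hs.1.le)
      calc _ ≤ _ := norm_mul_le _ _
        _ ≤ K * ‖y - x‖ * 1 := mul_le_mul (hAle s hs y hy) h4 (norm_nonneg _) (by positivity)
        _ = _ := mul_one _)
    (integrable_const _)
    (by
      refine (ae_restrict_iff' measurableSet_Ioc).2 (ae_of_all _ fun s hs => ?_)
      set P := fderiv ℝ (X (t - s)) (X s x) with hPdef
      have h1 : HasFDerivAt (fun y => fderiv ℝ g (X s y))
          ((fderiv ℝ (fderiv ℝ g) (X s x)).comp (fderiv ℝ (X s) x)) x := by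
        have hc : ContDiff ℝ 1 (fderiv ℝ g) := hg.contDiff.fderiv_right (by norm_num)
        exact ((hc.differentiable one_ne_zero) (X s x)).hasFDerivAt.comp x
          (hX.differentiableAt hg hγ hx hs.1.le).hasFDerivAt
      have h2 : HasFDerivAt (fun y => P * (fderiv ℝ g (X s x) - fderiv ℝ g (X s y)) *
          fderiv ℝ (X s) x) (sandwich P (fderiv ℝ (fderiv ℝ g) (X s x)) (fderiv ℝ (X s) x)) x := by
        have := (ContinuousLinearMap.compL ℝ H H H P ∘L
          (ContinuousLinearMap.compL ℝ H H H).flip (fderiv ℝ (X s) x)).hasFDerivAt.comp x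
          (h1.const_sub (fderiv ℝ g (X s x)))
        rw [ContinuousLinearMap.comp_neg] at this
        exact this
      -- Freezing the last factor at `x` costs a product of two Lipschitz differences, which is
      -- quadratic and has zero derivative. So no prior knowledge of the second derivative of the
      -- flow is needed.
      have h3 : HasFDerivAt (fun y => P * (fderiv ℝ g (X s x) - fderiv ℝ g (X s y)) *
          (fderiv ℝ (X s) y - fderiv ℝ (X s) x)) (0 : H →L[ℝ] H →L[ℝ] H) x := by
        refine hasFDerivAt_of_norm_sub_le_sq (C := K * C) ?_
        filter_upwards [isOpen_ball.mem_nhds hx] with y hy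
        have h4 := (hC s hs.1.le).norm_sub_le hy hx
        simp only [sub_self, mul_zero, sub_zero, zero_apply]
        calc _ ≤ _ := norm_mul_le _ _
          _ ≤ K * ‖y - x‖ * (C * ‖y - x‖) :=
            mul_le_mul (hAle s hs y hy) h4 (norm_nonneg _) (by positivity)
          _ = _ := by ring
      have h5 := h2.add h3
      rw [add_zero] at h5
      refine h5.congr_of_eventuallyEq (Filter.Eventually.of_forall fun y => ?_)
      simp only [hF, Pi.add_apply]
      rw [← mul_add, add_sub_cancel])).2
  rw [intervalIntegral.integral_of_le ht]
  refine (key.const_add (fderiv ℝ (X t) x)).congr_of_eventuallyEq ?_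
  filter_upwards [isOpen_ball.mem_nhds hx] with y hy
  have := hX.fderiv_sub_fderiv hg hγ hx hy ht
  rw [intervalIntegral.integral_of_le ht] at this
  rw [← this, add_sub_cancel]

end IsFlow

end FlowDerivative

/-! ### A calculus of families with weighted bounds polynomial in the size of the datum. -/

section PolyBdd

variable {ι T T' H : Type} [TopologicalSpace T] [TopologicalSpace T'] [NormedAddCommGroup H]
  [NormedSpace ℝ H]

/-- The functions `G i τ` on `B(0, R)` depend continuously on the time parameter `τ` and the space
variable, and are bounded by `w τ` times a power of `M i` that does not depend on `i`. -/
def UnifBdd (R : ℝ) (M : ι → ℝ) (w : T → ℝ) {V : Type} [NormedAddCommGroup V]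
    (G : ι → T → H → V) : Prop :=
  (∀ i, Continuous fun p : T × ball (0 : H) R => G i p.1 p.2) ∧
    ∃ m : ℕ, ∀ i τ, ∀ x ∈ ball (0 : H) R, ‖G i τ x‖ ≤ M i ^ m * w τ

/-- `UnifBdd` for the derivatives up to order `k` in the space variable. -/
def PolyBdd (R : ℝ) (M : ι → ℝ) (w : T → ℝ) : ℕ → ∀ {V : Type} [NormedAddCommGroup V]
    [NormedSpace ℝ V], (ι → T → H → V) → Prop
  | 0, _, _, _, G => UnifBdd R M w G
  | k + 1, _, _, _, G => UnifBdd R M w G ∧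
      (∀ i τ, ∀ x ∈ ball (0 : H) R, DifferentiableAt ℝ (G i τ) x) ∧
      PolyBdd R M w k fun i τ => fderiv ℝ (G i τ)

variable {V V' V'' : Type} [NormedAddCommGroup V] [NormedSpace ℝ V] [NormedAddCommGroup V']
  [NormedSpace ℝ V'] [NormedAddCommGroup V''] [NormedSpace ℝ V'']
variable {R : ℝ} {M : ι → ℝ} {w w' : T → ℝ} {k : ℕ} {G : ι → T → H → V}

theorem fderiv_eq_of_eqOn_ball {F F' : H → V} (h : EqOn F F' (ball 0 R)) :
    EqOn (fderiv ℝ F) (fderiv ℝ F') (ball 0 R) := fun x hx => by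
  have : F =ᶠ[𝓝 x] F' := by filter_upwards [isOpen_ball.mem_nhds hx] with y hy using h hy
  exact this.fderiv_eq

/-- This is the purpose of `2 ≤ M i`: every constant that does not depend on `i` is absorbed by
raising the exponent. -/
theorem exists_le_pow (hM : ∀ i, 2 ≤ M i) (C : ℝ) : ∃ c : ℕ, ∀ i, C ≤ M i ^ c := by
  obtain ⟨c, hc⟩ := pow_unbounded_of_one_lt C (one_lt_two)
  exact ⟨c, fun i => hc.le.trans (pow_le_pow_left₀ zero_le_two (hM i) c)⟩

namespace UnifBdd

theorem congr {G' : ι → T → H → V} (h : UnifBdd R M w G)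
    (hG : ∀ i τ, EqOn (G i τ) (G' i τ) (ball 0 R)) : UnifBdd R M w G' := by
  obtain ⟨hc, m, hm⟩ := h
  refine ⟨fun i => (hc i).congr fun p => hG i p.1 p.2.2, m, fun i τ x hx => ?_⟩
  rw [← hG i τ hx]
  exact hm i τ x hx

theorem weight_mono (hM : ∀ i, 2 ≤ M i) (h : UnifBdd R M w G) (C : ℝ) (hw' : ∀ τ, 0 ≤ w' τ)
    (hw : ∀ τ, w τ ≤ C * w' τ) : UnifBdd R M w' G := by
  obtain ⟨hc, m, hm⟩ := h
  obtain ⟨c, hC⟩ := exists_le_pow hM C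
  refine ⟨hc, m + c, fun i τ x hx => (hm i τ x hx).trans ?_⟩
  have h0 : 0 ≤ M i := zero_le_two.trans (hM i)
  rw [pow_add, mul_assoc]
  exact mul_le_mul_of_nonneg_left ((hw τ).trans (mul_le_mul_of_nonneg_right (hC i) (hw' τ)))
    (pow_nonneg h0 m)

theorem add (hM : ∀ i, 2 ≤ M i) {G' : ι → T → H → V} (h : UnifBdd R M w G)
    (h' : UnifBdd R M w G') : UnifBdd R M w fun i τ x => G i τ x + G' i τ x := by
  obtain ⟨hc, m, hm⟩ := h
  obtain ⟨hc', m', hm'⟩ := h'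
  refine ⟨fun i => (hc i).add (hc' i), max m m' + 1, fun i τ x hx => ?_⟩
  have h1 : 1 ≤ M i := one_le_two.trans (hM i)
  have h0 : 0 ≤ M i := zero_le_one.trans h1
  have hw : 0 ≤ w τ := nonneg_of_mul_nonneg_right ((norm_nonneg _).trans (hm i τ x hx))
    (pow_pos (zero_lt_one.trans_le h1) m)
  calc _ ≤ M i ^ m * w τ + M i ^ m' * w τ :=
        (norm_add_le _ _).trans (add_le_add (hm i τ x hx) (hm' i τ x hx))
    _ ≤ M i ^ (max m m') * w τ + M i ^ (max m m') * w τ := by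
        gcongr <;> first | exact h1 | simp
    _ = 2 * (M i ^ (max m m') * w τ) := by ring
    _ ≤ M i * (M i ^ (max m m') * w τ) := by gcongr; exact hM i
    _ = _ := by ring

theorem clm (hM : ∀ i, 2 ≤ M i) (L : V →L[ℝ] V') (h : UnifBdd R M w G) :
    UnifBdd R M w fun i τ x => L (G i τ x) := by
  obtain ⟨hc, m, hm⟩ := h
  obtain ⟨c, hC⟩ := exists_le_pow hM ‖L‖
  refine ⟨fun i => L.continuous.comp (hc i), c + m, fun i τ x hx => ?_⟩
  have h0 : 0 ≤ M i := zero_le_two.trans (hM i)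
  rw [pow_add, mul_assoc]
  exact (L.le_opNorm _).trans (mul_le_mul (hC i) (hm i τ x hx) (norm_nonneg _) (pow_nonneg h0 c))

theorem bilin (hM : ∀ i, 2 ≤ M i) (B : V →L[ℝ] V' →L[ℝ] V'') {G' : ι → T → H → V'}
    (h : UnifBdd R M w G) (h' : UnifBdd R M w' G') :
    UnifBdd R M (fun τ => w τ * w' τ) fun i τ x => B (G i τ x) (G' i τ x) := by
  obtain ⟨hc, m, hm⟩ := h
  obtain ⟨hc', m', hm'⟩ := h'
  obtain ⟨c, hC⟩ := exists_le_pow hM ‖B‖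
  refine ⟨fun i => (B.continuous.comp (hc i)).clm_apply (hc' i), c + m + m', fun i τ x hx => ?_⟩
  have h0 : 0 ≤ M i := zero_le_two.trans (hM i)
  calc _ ≤ ‖B‖ * ‖G i τ x‖ * ‖G' i τ x‖ := B.le_opNorm₂ _ _
    _ ≤ M i ^ c * (M i ^ m * w τ) * (M i ^ m' * w' τ) := by
        have h1 := hm i τ x hx
        have h2 := hm' i τ x hx
        have h3 := (norm_nonneg _).trans h1
        refine mul_le_mul (mul_le_mul (hC i) h1 (norm_nonneg _) (pow_nonneg h0 c)) h2
          (norm_nonneg _) (mul_nonneg (pow_nonneg h0 c) h3)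
    _ = _ := by ring

theorem reindex (σ : T' → T) (hσ : Continuous σ) (h : UnifBdd R M w G) :
    UnifBdd R M (fun τ => w (σ τ)) fun i τ x => G i (σ τ) x :=
  ⟨fun i => (h.1 i).comp ((hσ.comp continuous_fst).prodMk continuous_snd),
    h.2.imp fun _ hm i τ x hx => hm i (σ τ) x hx⟩

theorem comp (h : UnifBdd R M w G) {X : ι → T → H → H}
    (hX : ∀ i, Continuous fun p : T × ball (0 : H) R => X i p.1 p.2)
    (hXm : ∀ i τ, MapsTo (X i τ) (ball 0 R) (ball 0 R)) :
    UnifBdd R M w fun i τ x => G i τ (X i τ x) :=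
  ⟨fun i => (h.1 i).comp (f := fun p : T × ball (0 : H) R =>
      (p.1, (⟨X i p.1 p.2, hXm i p.1 p.2.2⟩ : ball (0 : H) R)))
      (continuous_fst.prodMk ((hX i).subtype_mk _)),
    h.2.imp fun _ hm i τ _ hx => hm i τ _ (hXm i τ hx)⟩

end UnifBdd

namespace PolyBdd

theorem unifBdd (h : PolyBdd R M w k G) : UnifBdd R M w G := by
  cases k with
  | zero => exact h
  | succ k => exact h.1

theorem of_succ (h : PolyBdd R M w (k + 1) G) : PolyBdd R M w k G := by
  induction k generalizing V with
  | zero => exact h.1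
  | succ k ih => exact ⟨h.1, h.2.1, ih h.2.2⟩

theorem of_le {l : ℕ} (hkl : k ≤ l) (h : PolyBdd R M w l G) : PolyBdd R M w k G := by
  induction hkl with
  | refl => exact h
  | step _ ih => exact ih h.of_succ

theorem congr {G' : ι → T → H → V} (h : PolyBdd R M w k G)
    (hG : ∀ i τ, EqOn (G i τ) (G' i τ) (ball 0 R)) : PolyBdd R M w k G' := by
  induction k generalizing V with
  | zero => exact UnifBdd.congr h hG
  | succ k ih =>
    refine ⟨h.1.congr hG, fun i τ x hx => (h.2.1 i τ x hx).congr_of_eventuallyEq ?_,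
      ih h.2.2 fun i τ => fderiv_eq_of_eqOn_ball (hG i τ)⟩
    filter_upwards [isOpen_ball.mem_nhds hx] with y hy using (hG i τ hy).symm

theorem weight_mono (hM : ∀ i, 2 ≤ M i) (h : PolyBdd R M w k G) (C : ℝ) (hw' : ∀ τ, 0 ≤ w' τ)
    (hw : ∀ τ, w τ ≤ C * w' τ) : PolyBdd R M w' k G := by
  induction k generalizing V with
  | zero => exact UnifBdd.weight_mono hM h C hw' hw
  | succ k ih => exact ⟨h.1.weight_mono hM C hw' hw, h.2.1, ih h.2.2⟩

theorem add (hM : ∀ i, 2 ≤ M i) {G' : ι → T → H → V} (h : PolyBdd R M w k G)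
    (h' : PolyBdd R M w k G') : PolyBdd R M w k fun i τ x => G i τ x + G' i τ x := by
  induction k generalizing V with
  | zero => exact UnifBdd.add hM h h'
  | succ k ih =>
    exact ⟨h.1.add hM h'.1, fun i τ x hx => (h.2.1 i τ x hx).add (h'.2.1 i τ x hx),
      (ih h.2.2 h'.2.2).congr fun i τ x hx =>
        (fderiv_fun_add (h.2.1 i τ x hx) (h'.2.1 i τ x hx)).symm⟩

theorem clm (hM : ∀ i, 2 ≤ M i) (L : V →L[ℝ] V') (h : PolyBdd R M w k G) :
    PolyBdd R M w k fun i τ x => L (G i τ x) := by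
  induction k generalizing V V' with
  | zero => exact UnifBdd.clm hM L h
  | succ k ih =>
    exact ⟨h.1.clm hM L, fun i τ x hx => L.differentiableAt.comp x (h.2.1 i τ x hx),
      (ih (ContinuousLinearMap.compL ℝ H V V' L) h.2.2).congr fun i τ x hx =>
        (L.hasFDerivAt.comp x (h.2.1 i τ x hx).hasFDerivAt).fderiv.symm⟩

theorem bilin (hM : ∀ i, 2 ≤ M i) (B : V →L[ℝ] V' →L[ℝ] V'') {G' : ι → T → H → V'}
    (h : PolyBdd R M w k G) (h' : PolyBdd R M w' k G') :
    PolyBdd R M (fun τ => w τ * w' τ) k fun i τ x => B (G i τ x) (G' i τ x) := by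
  induction k generalizing V V' V'' with
  | zero => exact UnifBdd.bilin hM B h h'
  | succ k ih =>
    have hd := fun i τ x hx => B.hasFDerivAt_of_bilinear (h.2.1 i τ x hx).hasFDerivAt
      (h'.2.1 i τ x hx).hasFDerivAt
    exact ⟨h.1.bilin hM B h'.1, fun i τ x hx => (hd i τ x hx).differentiableAt,
      ((ih (B.precompR H) h.of_succ h'.2.2).add hM (ih (B.precompL H) h.2.2 h'.of_succ)).congr
        fun i τ x hx => (hd i τ x hx).fderiv.symm⟩

theorem reindex (σ : T' → T) (hσ : Continuous σ) (h : PolyBdd R M w k G) :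
    PolyBdd R M (fun τ => w (σ τ)) k fun i τ x => G i (σ τ) x := by
  induction k generalizing V with
  | zero => exact UnifBdd.reindex σ hσ h
  | succ k ih => exact ⟨h.1.reindex σ hσ, fun i τ x hx => h.2.1 i (σ τ) x hx, ih h.2.2⟩

theorem sum (hM : ∀ i, 2 ≤ M i) (hw : ∀ τ, 0 ≤ w τ) {J : Type} (s : Finset J)
    {F : J → ι → T → H → V} (h : ∀ j, PolyBdd R M w k (F j)) :
    PolyBdd R M w k fun i τ x => ∑ j ∈ s, F j i τ x := by
  classical
  induction s using Finset.induction_on with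
  | empty =>
    have h0 : ∀ (l : ℕ) {W : Type} [NormedAddCommGroup W] [NormedSpace ℝ W],
        PolyBdd R M w l fun (_ : ι) (_ : T) (_ : H) => (0 : W) := by
      intro l
      induction l with
      | zero =>
        intro W _ _
        exact ⟨fun _ => continuous_const, 0, fun i τ x _ => by simpa using hw τ⟩
      | succ l ih =>
        intro W _ _
        exact ⟨⟨fun _ => continuous_const, 0, fun i τ x _ => by simpa using hw τ⟩,
          fun i τ x _ => differentiableAt_const _, ih.congr fun i τ x _ => by simp⟩
    simpa using h0 k
  | insert j s hj ih => simpa only [Finset.sum_insert hj] using (h j).add hM ih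

/-- The derivative of a composition, with the product of the weights. -/
theorem fderiv_comp_aux (hM : ∀ i, 2 ≤ M i) {X : ι → T → H → H}
    (hG : ∀ i τ, ∀ x ∈ ball (0 : H) R, DifferentiableAt ℝ (G i τ) x)
    (hXm : ∀ i τ, MapsTo (X i τ) (ball 0 R) (ball 0 R))
    (hXd : ∀ i τ, ∀ x ∈ ball (0 : H) R, DifferentiableAt ℝ (X i τ) x)
    (h : PolyBdd R M w k fun i τ x => fderiv ℝ (G i τ) (X i τ x))
    (hX : PolyBdd R M w' k fun i τ => fderiv ℝ (X i τ)) :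
    PolyBdd R M (fun τ => w τ * w' τ) k fun i τ => fderiv ℝ fun x => G i τ (X i τ x) :=
  (h.bilin hM (ContinuousLinearMap.compL ℝ H H V) hX).congr fun i τ x hx =>
    ((hG i τ _ (hXm i τ hx)).hasFDerivAt.comp x (hXd i τ x hx).hasFDerivAt).fderiv.symm

/-- By the chain rule each derivative of the outer function brings a factor `DX` of weight `w' ≤ 1`.
Here that gain is discarded; `fderiv_comp` retains one such factor, and with it the decay. -/
theorem comp (hM : ∀ i, 2 ≤ M i) {X : ι → T → H → H} (h : PolyBdd R M w k G)
    (hw : ∀ τ, 0 ≤ w τ) (hw' : ∀ τ, w' τ ≤ 1) (hX : PolyBdd R M w' k X)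
    (hXm : ∀ i τ, MapsTo (X i τ) (ball 0 R) (ball 0 R)) :
    PolyBdd R M w k fun i τ x => G i τ (X i τ x) := by
  induction k generalizing V with
  | zero => exact UnifBdd.comp h hX.1 hXm
  | succ k ih =>
    refine ⟨h.1.comp hX.1.1 hXm, fun i τ _ hx =>
      (h.2.1 i τ _ (hXm i τ hx)).comp _ (hX.2.1 i τ _ hx), ?_⟩
    refine (fderiv_comp_aux hM h.2.1 hXm hX.2.1 (ih h.2.2 hX.of_succ) hX.2.2).weight_mono hM 1
      hw fun τ => ?_
    rw [one_mul]
    exact mul_le_of_le_one_right (hw τ) (hw' τ)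

/-- The derivative of a composition, with the product of the weights. -/
theorem fderiv_comp (hM : ∀ i, 2 ≤ M i) {X : ι → T → H → H}
    (hG : ∀ i τ, ∀ x ∈ ball (0 : H) R, DifferentiableAt ℝ (G i τ) x)
    (h : PolyBdd R M w k fun i τ => fderiv ℝ (G i τ))
    (hw : ∀ τ, 0 ≤ w τ) (hw' : ∀ τ, w' τ ≤ 1) (hX : PolyBdd R M w' (k + 1) X)
    (hXm : ∀ i τ, MapsTo (X i τ) (ball 0 R) (ball 0 R)) :
    PolyBdd R M (fun τ => w τ * w' τ) k fun i τ => fderiv ℝ fun x => G i τ (X i τ x) :=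
  fderiv_comp_aux hM hG hXm hX.2.1 (h.comp hM hw hw' hX.of_succ hXm) hX.2.2

end PolyBdd

section Integral

variable {K : ι → ℝ≥0 × ℝ≥0 → H → V} {v : ℝ≥0 × ℝ≥0 → ℝ} {W : ℝ≥0 → ℝ}

theorem UnifBdd.continuous_slice (h : UnifBdd R M v K) (i : ι) (t : ℝ≥0) {x : H} (hx : x ∈ ball 0 R) :
    Continuous fun s : ℝ => K i (s.toNNReal, (t - s).toNNReal) x :=
  (h.1 i).comp (f := fun s : ℝ => ((s.toNNReal, (t - s).toNNReal), (⟨x, hx⟩ : ball (0 : H) R)))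
    (by fun_prop)

/-- The two time parameters of the kernel are the elapsed time `s` and the remaining time `t - s` in
Duhamel's formula. The truncation `Real.toNNReal` extends the integrand continuously to all real
`s`; on `[0, t]` it has no effect. -/
theorem UnifBdd.integral (hM : ∀ i, 2 ≤ M i) (hv : Continuous v) (hW : ∀ t, 0 ≤ W t) (C : ℝ)
    (hvW : ∀ t : ℝ≥0, ∫ s in (0 : ℝ)..t, v (s.toNNReal, (t - s).toNNReal) ≤ C * W t)
    (h : UnifBdd R M v K) :
    UnifBdd R M W fun i t x => ∫ s in (0 : ℝ)..t, K i (s.toNNReal, (t - s).toNNReal) x := by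
  refine UnifBdd.weight_mono hM (w := fun t : ℝ≥0 => ∫ s in (0 : ℝ)..t,
    v (s.toNNReal, (t - s).toNNReal)) ?_ C hW hvW
  have hc := h.1
  obtain ⟨m, hm⟩ := h.2
  refine ⟨fun i => ?_, m, fun i t x hx => ?_⟩
  · refine intervalIntegral.continuous_parametric_intervalIntegral_of_continuous
      (f := fun (p : ℝ≥0 × ball (0 : H) R) (s : ℝ) => K i (s.toNNReal, (p.1 - s).toNNReal) p.2)
      ?_ (NNReal.continuous_coe.comp continuous_fst)
    exact (hc i).comp (f := fun q : (ℝ≥0 × ball (0 : H) R) × ℝ =>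
      ((q.2.toNNReal, (q.1.1 - q.2).toNNReal), q.1.2)) (by fun_prop)
  · rw [← intervalIntegral.integral_const_mul]
    refine intervalIntegral.norm_integral_le_of_norm_le t.coe_nonneg
      (ae_of_all _ fun s _ => hm i _ x hx) (Continuous.intervalIntegrable ?_ _ _)
    exact continuous_const.mul (hv.comp (by fun_prop))

theorem hasFDerivAt_timeIntegral (hv : Continuous v) (h : PolyBdd R M v 1 K) (i : ι) (t : ℝ≥0) {x : H}
    (hx : x ∈ ball 0 R) : HasFDerivAt
      (fun x => ∫ s in (0 : ℝ)..t, K i (s.toNNReal, (t - s).toNNReal) x)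
      (∫ s in (0 : ℝ)..t, fderiv ℝ (K i (s.toNNReal, (t - s).toNNReal)) x) x := by
  obtain ⟨hu, hd, hu'⟩ := h
  obtain ⟨m, hm⟩ := hu'.unifBdd.2
  simp only [intervalIntegral.integral_of_le t.coe_nonneg]
  refine hasFDerivAt_integral_of_dominated_of_fderiv_le (𝕜 := ℝ) (s := ball 0 R)
    (μ := volume.restrict (Ioc (0 : ℝ) t))
    (bound := fun s => M i ^ m * v (s.toNNReal, (t - s).toNNReal))
    (F' := fun x s => fderiv ℝ (K i (s.toNNReal, (t - s).toNNReal)) x)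
    (isOpen_ball.mem_nhds hx) ?_ ?_ ?_ ?_ ?_ ?_
  · filter_upwards [isOpen_ball.mem_nhds hx] with y hy
    exact (hu.continuous_slice i t hy).aestronglyMeasurable
  · exact (hu.continuous_slice i t hx).integrableOn_Ioc
  · exact (hu'.unifBdd.continuous_slice i t hx).aestronglyMeasurable
  · exact ae_of_all _ fun s y hy => hm i _ y hy
  · exact Continuous.integrableOn_Ioc (continuous_const.mul (hv.comp (by fun_prop)))
  · exact ae_of_all _ fun s y hy => (hd i _ y hy).hasFDerivAt

theorem PolyBdd.integral (hM : ∀ i, 2 ≤ M i) (hv : Continuous v) (hW : ∀ t, 0 ≤ W t) (C : ℝ)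
    (hvW : ∀ t : ℝ≥0, ∫ s in (0 : ℝ)..t, v (s.toNNReal, (t - s).toNNReal) ≤ C * W t)
    (h : PolyBdd R M v k K) :
    PolyBdd R M W k fun i t x => ∫ s in (0 : ℝ)..t, K i (s.toNNReal, (t - s).toNNReal) x := by
  induction k generalizing V with
  | zero => exact UnifBdd.integral hM hv hW C hvW h
  | succ k ih =>
    have h1 : PolyBdd R M v 1 K := h.of_le (by omega)
    exact ⟨UnifBdd.integral hM hv hW C hvW h.1,
      fun i t x hx => (hasFDerivAt_timeIntegral hv h1 i t hx).differentiableAt,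
      (ih h.2.2).congr fun i t x hx => (hasFDerivAt_timeIntegral hv h1 i t hx).fderiv.symm⟩

end Integral

end PolyBdd

/-! ### Exponential weights and their convolutions. -/

section ExpWeight

/-- The weight `e^{-c t}`. -/
noncomputable def expWeight (c : ℝ) (t : ℝ≥0) : ℝ := Real.exp (-c * t)

theorem expWeight_nonneg (c : ℝ) (t : ℝ≥0) : 0 ≤ expWeight c t := (Real.exp_pos _).le

theorem expWeight_le_one {c : ℝ} (hc : 0 ≤ c) (t : ℝ≥0) : expWeight c t ≤ 1 := by
  rw [expWeight, Real.exp_le_one_iff]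
  linarith [mul_nonneg hc t.coe_nonneg]

theorem expWeight_anti {a b : ℝ} (h : a ≤ b) (t : ℝ≥0) : expWeight b t ≤ expWeight a t := by
  rw [expWeight, expWeight, Real.exp_le_exp]
  linarith [mul_le_mul_of_nonneg_right h t.coe_nonneg]

theorem continuous_expWeight (c : ℝ) : Continuous (expWeight c) := by
  unfold expWeight; fun_prop

/-- The slower exponential wins a convolution. The gap `a < b` excludes the resonant case, where the
integral would be `t e^{-at}`. -/
theorem integral_exp_conv_le {a b : ℝ} (h : a < b) (t : ℝ) :
    ∫ s in (0 : ℝ)..t, Real.exp (-a * s) * Real.exp (-b * (t - s)) ≤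
      1 / (b - a) * Real.exp (-a * t) := by
  have hba : 0 < b - a := sub_pos.2 h
  have h1 : ∀ s, Real.exp (-a * s) * Real.exp (-b * (t - s)) =
      Real.exp (-b * t) * Real.exp ((b - a) * s) := fun s => by
    rw [← Real.exp_add, ← Real.exp_add]; ring_nf
  simp only [h1]
  rw [intervalIntegral.integral_const_mul,
    intervalIntegral.integral_comp_mul_left (fun s => Real.exp s) hba.ne', integral_exp, smul_eq_mul]
  have h2 : Real.exp (-b * t) * Real.exp ((b - a) * t) = Real.exp (-a * t) := by
    rw [← Real.exp_add]; ring_nf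
  calc _ = (b - a)⁻¹ * (Real.exp (-b * t) * Real.exp ((b - a) * t)
          - Real.exp (-b * t) * Real.exp ((b - a) * 0)) := by ring
    _ ≤ (b - a)⁻¹ * (Real.exp (-a * t) - 0) := by
        rw [h2]; gcongr; positivity
    _ = _ := by rw [sub_zero, one_div]

theorem integral_expWeight_conv_le {a b : ℝ} (h : a < b) (t : ℝ≥0) :
    ∫ s in (0 : ℝ)..t, expWeight a s.toNNReal * expWeight b (t - s).toNNReal ≤
      1 / (b - a) * expWeight a t := by
  refine le_of_eq_of_le (intervalIntegral.integral_congr fun s hs => ?_) (integral_exp_conv_le h t)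
  rw [uIcc_of_le t.coe_nonneg] at hs
  simp only [expWeight, Real.coe_toNNReal _ hs.1, Real.coe_toNNReal _ (sub_nonneg.2 hs.2)]

theorem integral_expWeight_conv_le' {a b : ℝ} (h : a < b) (t : ℝ≥0) :
    ∫ s in (0 : ℝ)..t, expWeight b s.toNNReal * expWeight a (t - s).toNNReal ≤
      1 / (b - a) * expWeight a t := by
  refine le_of_eq_of_le ?_ (integral_expWeight_conv_le h t)
  have := intervalIntegral.integral_comp_sub_left
    (fun s => expWeight a s.toNNReal * expWeight b (t - s).toNNReal) (a := 0) (b := t) (t : ℝ)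
  rw [sub_zero, sub_self] at this
  rw [← this]
  refine intervalIntegral.integral_congr fun s _ => ?_
  simp only [sub_sub_cancel]
  ring

end ExpWeight

/-! ### Decay of all spatial derivatives of the flow at the full rate. -/

section FlowFamily

variable {ι H : Type} [NormedAddCommGroup H] [InnerProductSpace ℝ H] [FiniteDimensional ℝ H]
variable {γ R : ℝ} {M : ι → ℝ} {g : ι → H → H} {X : ι → ℝ → H → H}

theorem IsFlow.unifBdd (hM : ∀ i, 2 ≤ M i) (hγ : 0 < γ) (hg : ∀ i, IsMonotoneField γ R (g i))
    (hX : ∀ i, IsFlow R (g i) (X i)) :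
    UnifBdd R M (expWeight γ) fun i (t : ℝ≥0) => X i t := by
  obtain ⟨m, hm⟩ := exists_le_pow hM R
  refine ⟨fun i => (hX i).continuous (hg i) hγ, m, fun i t x hx => ?_⟩
  refine ((hX i).norm_le (hg i) hx t.coe_nonneg).trans ?_
  rw [mul_comm]
  exact mul_le_mul_of_nonneg_right ((mem_ball_zero_iff.1 hx).le.trans (hm i)) (Real.exp_pos _).le

theorem PolyBdd.sandwich {T : Type} [TopologicalSpace T] (hM : ∀ i, 2 ≤ M i) {k : ℕ}
    {w₁ w₂ w₃ : T → ℝ} {P Q : ι → T → H → H →L[ℝ] H} {D : ι → T → H → H →L[ℝ] H →L[ℝ] H}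
    (hP : PolyBdd R M w₁ k P) (hD : PolyBdd R M w₂ k D) (hQ : PolyBdd R M w₃ k Q) :
    PolyBdd R M (fun τ => w₁ τ * (w₃ τ * (w₂ τ * w₃ τ))) k
      fun i τ x => SGDExpansion.sandwich (P i τ x) (D i τ x) (Q i τ x) := by
  have h1 := hD.bilin (V'' := H →L[ℝ] H →L[ℝ] H) hM (ContinuousLinearMap.compL ℝ H H (H →L[ℝ] H)) hQ
  have h2 := (hQ.clm (V' := (H →L[ℝ] H) →L[ℝ] H →L[ℝ] H) hM
    (ContinuousLinearMap.compL ℝ H H H).flip).bilin (V'' := H →L[ℝ] H →L[ℝ] H) hM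
    (ContinuousLinearMap.compL ℝ H (H →L[ℝ] H) (H →L[ℝ] H)) h1
  have h3 := (hP.clm (V' := (H →L[ℝ] H) →L[ℝ] H →L[ℝ] H) hM
    (ContinuousLinearMap.compL ℝ H H H)).bilin (V'' := H →L[ℝ] H →L[ℝ] H) hM
    (ContinuousLinearMap.compL ℝ H (H →L[ℝ] H) (H →L[ℝ] H)) h2
  exact h3.clm (V' := H →L[ℝ] H →L[ℝ] H) hM (-ContinuousLinearMap.id ℝ (H →L[ℝ] H →L[ℝ] H))

/-- In the integral formula for `D²X_t` the factor `DX_s` occurs twice, so the integrand has weight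
`e^{-2γs} e^{-γ(t-s)}`. The rates `2γ` and `γ` differ, hence the convolution returns `e^{-γt}`
without loss and the induction on `k` closes. -/
theorem IsFlow.polyBdd_fderiv (hM : ∀ i, 2 ≤ M i) (hγ : 0 < γ)
    (hg : ∀ i, IsMonotoneField γ R (g i)) (hX : ∀ i, IsFlow R (g i) (X i)) {k : ℕ}
    (hDg : PolyBdd R M (fun _ : Unit => 1) k fun i _ => fderiv ℝ (g i)) :
    PolyBdd R M (expWeight γ) k fun i (t : ℝ≥0) => fderiv ℝ (X i t) := by
  have hu : UnifBdd R M (expWeight γ) fun i (t : ℝ≥0) => fderiv ℝ (X i t) :=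
    ⟨fun i => (hX i).continuous_fderiv (hg i) hγ, 0, fun i t x hx => by
      rw [pow_zero, one_mul]
      exact (hX i).norm_fderiv_le (hg i) hx t.coe_nonneg⟩
  induction k with
  | zero => exact hu
  | succ k ih =>
    have hY := ih hDg.of_succ
    have hXk : PolyBdd R M (expWeight γ) k fun i (t : ℝ≥0) => X i t :=
      PolyBdd.of_succ ⟨IsFlow.unifBdd hM hγ hg hX,
        fun i t x hx => (hX i).differentiableAt (hg i) hγ hx t.coe_nonneg, hY⟩
    refine ⟨hu, fun i t x hx =>
      ((hX i).hasFDerivAt_fderiv (hg i) hγ hx t.coe_nonneg).differentiableAt, ?_⟩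
    have hXs := hXk.reindex (fun τ : ℝ≥0 × ℝ≥0 => τ.1) continuous_fst
    have hmaps : ∀ i (τ : ℝ≥0 × ℝ≥0), MapsTo (X i τ.1) (ball 0 R) (ball 0 R) :=
      fun i τ _ hx => (hX i).mem _ hx _ τ.1.coe_nonneg
    have hle : ∀ τ : ℝ≥0 × ℝ≥0, expWeight γ τ.1 ≤ 1 := fun τ => expWeight_le_one hγ.le _
    have hP := (hY.reindex (fun τ : ℝ≥0 × ℝ≥0 => τ.2) continuous_snd).comp hM
      (fun τ => expWeight_nonneg γ τ.2) hle hXs hmaps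
    have hD := (hDg.2.2.reindex (fun _ : ℝ≥0 × ℝ≥0 => ()) continuous_const).comp hM
      (fun _ => zero_le_one) hle hXs hmaps
    have hQ := hY.reindex (fun τ : ℝ≥0 × ℝ≥0 => τ.1) continuous_fst
    have hZ := (PolyBdd.sandwich hM hP hD hQ).weight_mono hM
      (w' := fun τ => expWeight (2 * γ) τ.1 * expWeight γ τ.2) 1
      (fun τ => mul_nonneg (expWeight_nonneg _ _) (expWeight_nonneg _ _)) (fun τ => by
        have : expWeight γ τ.1 * expWeight γ τ.1 = expWeight (2 * γ) τ.1 := by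
          rw [expWeight, expWeight, ← Real.exp_add]; ring_nf
        rw [← this]
        apply le_of_eq
        ring)
    refine (hZ.integral hM (W := expWeight γ) ?_ (expWeight_nonneg γ) (1 / (2 * γ - γ))
      (fun t => integral_expWeight_conv_le' (by linarith) t)).congr fun i t x hx => ?_
    · exact ((continuous_expWeight _).comp continuous_fst).mul
        ((continuous_expWeight _).comp continuous_snd)
    · rw [((hX i).hasFDerivAt_fderiv (hg i) hγ hx t.coe_nonneg).fderiv]
      refine intervalIntegral.integral_congr fun s hs => ?_
      rw [uIcc_of_le t.coe_nonneg] at hs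
      simp only [Real.coe_toNNReal _ hs.1, Real.coe_toNNReal _ (sub_nonneg.2 hs.2)]

theorem IsFlow.polyBdd (hM : ∀ i, 2 ≤ M i) (hγ : 0 < γ)
    (hg : ∀ i, IsMonotoneField γ R (g i)) (hX : ∀ i, IsFlow R (g i) (X i)) {k : ℕ}
    (hDg : PolyBdd R M (fun _ : Unit => 1) k fun i _ => fderiv ℝ (g i)) :
    PolyBdd R M (expWeight γ) (k + 1) fun i (t : ℝ≥0) => X i t :=
  ⟨IsFlow.unifBdd hM hγ hg hX, fun i t _ hx => (hX i).differentiableAt (hg i) hγ hx t.coe_nonneg,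
    IsFlow.polyBdd_fderiv hM hγ hg hX hDg⟩

end FlowFamily

/-! ### The operator `𝓛₂` and the Duhamel formula for the coefficients. -/

section Coefficients

variable {d : ℕ}

/-- The Riesz isomorphism as a continuous linear map. -/
noncomputable def riesz (d : ℕ) : (E d →L[ℝ] ℝ) →L[ℝ] E d :=
  LinearMap.toContinuousLinearMap
    { toFun := fun L => (InnerProductSpace.toDual ℝ (E d)).symm L
      map_add' := fun _ _ => map_add _ _ _
      map_smul' := fun c L => by simp }

theorem riesz_fderiv (v : E d → ℝ) (x : E d) : riesz d (fderiv ℝ v x) = gradient v x := rfl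

theorem inner_gradient_gradient (q v : E d → ℝ) (x : E d) :
    inner ℝ (gradient q x) (gradient v x) = fderiv ℝ q x (riesz d (fderiv ℝ v x)) := by
  rw [riesz_fderiv, gradient, InnerProductSpace.toDual_symm_apply]

theorem partialD_two (v : E d → ℝ) (x : E d) (i j : Fin d) : partialD ![j, i] v x =
    fderiv ℝ (fderiv ℝ v) x (EuclideanSpace.single j 1) (EuclideanSpace.single i 1) := by
  simp [partialD, iteratedFDeriv_two_apply]

/-- Derivatives on an open set depend only on the values there, which matters because the
coefficient functions are determined only on the ball. -/
theorem opL2_congr {f : E d → ℝ} {S : E d → Fin d → Fin d → ℝ} {R : ℝ} {v v' : E d → ℝ}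
    (h : EqOn v v' (ball 0 R)) : EqOn (opL2 f S v) (opL2 f S v') (ball 0 R) := fun x hx => by
  have h1 := fderiv_eq_of_eqOn_ball h
  have h2 := fderiv_eq_of_eqOn_ball h1
  simp only [opL2, partialD_two, inner_gradient_gradient, h1 hx, h2 hx]

variable {ι T : Type} [TopologicalSpace T] {R γ c : ℝ} {M : ι → ℝ} {w : T → ℝ}
variable {f φ : ι → E d → ℝ} {S : ι → E d → Fin d → Fin d → ℝ} {k : ℕ}

/-- `𝓛₂` sees only `Dv` and `D²v`. The decay hypothesis is therefore put on `fderiv ℝ v`, since the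
coefficients themselves need not tend to zero. -/
theorem PolyBdd.opL2 (hM : ∀ i, 2 ≤ M i) (hw : ∀ τ, 0 ≤ w τ) {v : ι → T → E d → ℝ}
    (hf : PolyBdd R M (fun _ : Unit => 1) (k + 1) fun i _ => fderiv ℝ (f i))
    (hS : PolyBdd R M (fun _ : Unit => 1) k fun i _ => S i)
    (hv : PolyBdd R M w (k + 1) fun i τ => fderiv ℝ (v i τ)) :
    PolyBdd R M w k fun i τ => SGDExpansion.opL2 (f i) (S i) (v i τ) := by
  have hq := (hf.bilin hM (ContinuousLinearMap.id ℝ (E d →L[ℝ] ℝ)) (hf.clm hM (riesz d))).2.2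
  have h1 := ((hq.reindex (fun _ : T => ()) continuous_const).bilin hM
    (ContinuousLinearMap.id ℝ (E d →L[ℝ] ℝ)) (hv.of_succ.clm hM (riesz d))).clm hM
    ((-(1 / 4 : ℝ)) • ContinuousLinearMap.id ℝ ℝ)
  have h2 := fun i j => ((hS.clm hM ((ContinuousLinearMap.proj (R := ℝ) (φ := fun _ : Fin d => ℝ) j).comp
    (ContinuousLinearMap.proj (R := ℝ) (φ := fun _ : Fin d => Fin d → ℝ) i))).reindex
      (fun _ : T => ()) continuous_const).bilin hM (ContinuousLinearMap.mul ℝ ℝ)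
    (hv.2.2.clm hM ((ContinuousLinearMap.apply ℝ ℝ (EuclideanSpace.single i (1 : ℝ))).comp
      (ContinuousLinearMap.apply ℝ (E d →L[ℝ] ℝ) (EuclideanSpace.single j (1 : ℝ)))))
  have hw1 : ∀ τ, 0 ≤ 1 * 1 * w τ := fun τ => by simpa using hw τ
  have h3 := (PolyBdd.sum hM (fun τ => by simpa using hw τ) Finset.univ fun i =>
    PolyBdd.sum hM (fun τ => by simpa using hw τ) Finset.univ (h2 i)).clm hM
    ((1 / 2 : ℝ) • ContinuousLinearMap.id ℝ ℝ)
  have h1' := h1.weight_mono hM (w' := w) 1 hw fun τ => by simp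
  have h3' := h3.weight_mono hM (w' := w) 1 hw fun τ => by simp
  refine (h1'.add hM h3').congr fun i τ x hx => ?_
  have e : (fun y => ‖gradient (f i) y‖ ^ 2) = fun y => fderiv ℝ (f i) y (riesz d (fderiv ℝ (f i) y)) := by
    ext1 y
    rw [← inner_gradient_gradient, real_inner_self_eq_norm_sq]
  simp only [SGDExpansion.opL2, partialD_two, inner_gradient_gradient, e]
  rfl

/-- The coefficient functions, given by transport along the flow `X` and Duhamel's formula. -/
noncomputable def coeffFun (f : E d → ℝ) (S : E d → Fin d → Fin d → ℝ) (φ : E d → ℝ)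
    (X : ℝ → E d → E d) : ℕ → ℝ → E d → ℝ
  | 0 => fun t x => φ (X t x)
  | l + 1 => fun t x => ∫ s in (0 : ℝ)..t, opL2 f S (coeffFun f S φ X l s) (X (t - s) x)

variable {X : ι → ℝ → E d → E d}

/-- `φ(X_t x)` is merely bounded, but its derivative `Dφ(X_t x) ∘ DX_t` inherits the weight of
`DX_t`. -/
theorem coeffFun_zero_polyBdd (hM : ∀ i, 2 ≤ M i) (hγ : 0 < γ)
    (hX : ∀ i, IsFlow R (gradient (f i)) (X i))
    (hXk : PolyBdd R M (expWeight γ) (k + 1) fun i (t : ℝ≥0) => X i t)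
    (hφ : PolyBdd R M (fun _ : Unit => 1) (k + 1) fun i _ => φ i) :
    PolyBdd R M (fun _ => 1) (k + 1) (fun i (t : ℝ≥0) => coeffFun (f i) (S i) (φ i) (X i) 0 t) ∧
    PolyBdd R M (expWeight γ) k
      (fun i (t : ℝ≥0) => fderiv ℝ (coeffFun (f i) (S i) (φ i) (X i) 0 t)) := by
  have hmaps : ∀ i (t : ℝ≥0), MapsTo (X i t) (ball 0 R) (ball 0 R) :=
    fun i t x hx => (hX i).mem x hx _ t.coe_nonneg
  have hφ' := hφ.reindex (fun _ : ℝ≥0 => ()) continuous_const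
  refine ⟨hφ'.comp hM (fun _ => zero_le_one) (expWeight_le_one hγ.le) hXk hmaps, ?_⟩
  refine (PolyBdd.fderiv_comp hM hφ'.2.1 hφ'.2.2 (fun _ => zero_le_one) (expWeight_le_one hγ.le) hXk
    hmaps).weight_mono hM 1 (expWeight_nonneg γ) fun τ => le_rfl

/-- The derivative of `(𝓛₂u_l(·,s))(X_{t-s} x)` has weight `e^{-cs} e^{-γ(t-s)}`, and as `c < γ` the
convolution reproduces the rate `c`. The function itself has the integrand weight `e^{-cs}` only;
its weight `W` serves regularity, not decay. -/
theorem coeffFun_succ_polyBdd (hM : ∀ i, 2 ≤ M i) (hγ : 0 < γ) (hc : c < γ)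
    (hX : ∀ i, IsFlow R (gradient (f i)) (X i))
    (hXk : PolyBdd R M (expWeight γ) (k + 1) fun i (t : ℝ≥0) => X i t)
    (hf : PolyBdd R M (fun _ : Unit => 1) (k + 2) fun i _ => fderiv ℝ (f i))
    (hS : PolyBdd R M (fun _ : Unit => 1) (k + 1) fun i _ => S i) {l : ℕ}
    (hl : PolyBdd R M (expWeight c) (k + 2)
      (fun i (t : ℝ≥0) => fderiv ℝ (coeffFun (f i) (S i) (φ i) (X i) l t))) :
    (∃ W, PolyBdd R M W (k + 1)
      (fun i (t : ℝ≥0) => coeffFun (f i) (S i) (φ i) (X i) (l + 1) t)) ∧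
    PolyBdd R M (expWeight c) k
      (fun i (t : ℝ≥0) => fderiv ℝ (coeffFun (f i) (S i) (φ i) (X i) (l + 1) t)) := by
  have hh := PolyBdd.opL2 hM (expWeight_nonneg c) hf hS hl
  have hh' := hh.reindex (fun τ : ℝ≥0 × ℝ≥0 => τ.1) continuous_fst
  have hXr := hXk.reindex (fun τ : ℝ≥0 × ℝ≥0 => τ.2) continuous_snd
  have hmaps : ∀ i (τ : ℝ≥0 × ℝ≥0), MapsTo (X i τ.2) (ball 0 R) (ball 0 R) :=
    fun i τ x hx => (hX i).mem x hx _ τ.2.coe_nonneg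
  have hle : ∀ τ : ℝ≥0 × ℝ≥0, expWeight γ τ.2 ≤ 1 := fun τ => expWeight_le_one hγ.le _
  have hK := hh'.comp hM (fun τ => expWeight_nonneg c τ.1) hle hXr hmaps
  have hDK := PolyBdd.fderiv_comp hM hh'.2.1 hh'.2.2 (fun τ => expWeight_nonneg c τ.1) hle hXr hmaps
  have hv : Continuous fun τ : ℝ≥0 × ℝ≥0 => expWeight c τ.1 :=
    (continuous_expWeight c).comp continuous_fst
  have hv' : Continuous fun τ : ℝ≥0 × ℝ≥0 => expWeight c τ.1 * expWeight γ τ.2 :=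
    hv.mul ((continuous_expWeight γ).comp continuous_snd)
  have e : ∀ i (t : ℝ≥0), EqOn (fun x => ∫ s in (0 : ℝ)..t, SGDExpansion.opL2 (f i) (S i)
      (coeffFun (f i) (S i) (φ i) (X i) l s.toNNReal) (X i (t - s).toNNReal x))
      (coeffFun (f i) (S i) (φ i) (X i) (l + 1) t) (ball 0 R) := fun i t x _ => by
    refine intervalIntegral.integral_congr fun s hs => ?_
    rw [uIcc_of_le t.coe_nonneg] at hs
    simp only [Real.coe_toNNReal _ hs.1, Real.coe_toNNReal _ (sub_nonneg.2 hs.2)]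
  refine ⟨⟨fun t : ℝ≥0 => ∫ s in (0 : ℝ)..t, expWeight c s.toNNReal, ?_⟩, ?_⟩
  · refine (hK.integral hM hv (fun t => ?_) 1 fun t => by rw [one_mul]).congr e
    exact intervalIntegral.integral_nonneg t.coe_nonneg fun s _ => expWeight_nonneg _ _
  · refine (hDK.integral hM hv' (expWeight_nonneg c) (1 / (γ - c))
      (fun t => integral_expWeight_conv_le hc t)).congr fun i t x hx => ?_
    rw [← fderiv_eq_of_eqOn_ball (e i t) hx]
    exact (hasFDerivAt_timeIntegral hv (hK.of_le (by omega)) i t hx).fderiv.symm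

end Coefficients

/-! ### Equivalence of the transport equation and Duhamel's formula. -/

section Solutions

variable {d : ℕ} {γ R : ℝ} {f : E d → ℝ} {X : ℝ → E d → E d}

theorem continuousOn_ball_Ici {V : Type*} [TopologicalSpace V] {G : E d → ℝ → V}
    (h : Continuous fun p : ℝ≥0 × ball (0 : E d) R => G p.2 p.1) :
    ContinuousOn (fun p : E d × ℝ => G p.1 p.2) (ball (0 : E d) R ×ˢ Ici 0) := by
  rw [continuousOn_iff_continuous_domRestrict]
  exact h.comp (f := fun p : ↥(ball (0 : E d) R ×ˢ Ici (0 : ℝ)) =>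
    ((⟨p.1.2, p.2.2⟩ : ℝ≥0), (⟨p.1.1, p.2.1⟩ : ball (0 : E d) R)))
    (((continuous_snd.comp continuous_subtype_val).subtype_mk _).prodMk
      ((continuous_fst.comp continuous_subtype_val).subtype_mk _))

theorem opL1_eq (v : E d → ℝ) (x : E d) : opL1 f v x = -fderiv ℝ v x (gradient f x) := by
  rw [opL1, real_inner_comm, gradient, InnerProductSpace.toDual_symm_apply]

theorem IsFlow.continuous_transport (hX : IsFlow R (gradient f) X) {h : E d → ℝ → ℝ}
    (hh : Continuous fun p : ℝ≥0 × ball (0 : E d) R => h p.2 p.1) {x : E d} (hx : x ∈ ball 0 R) :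
    Continuous fun q : ℝ × ℝ => h (X q.2.toNNReal x) q.1.toNNReal := by
  have hXc : Continuous fun r : ℝ => X r.toNNReal x :=
    (hX.continuousOn_time hx).comp_continuous (f := fun r : ℝ => (r.toNNReal : ℝ)) (by fun_prop)
      fun r => r.toNNReal.coe_nonneg
  exact hh.comp (f := fun q : ℝ × ℝ =>
    (q.1.toNNReal, (⟨X q.2.toNNReal x, hX.mem x hx _ (NNReal.coe_nonneg _)⟩ : ball (0 : E d) R)))
    ((continuous_real_toNNReal.comp continuous_fst).prodMk
      ((hXc.comp continuous_snd).subtype_mk _))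

theorem IsFlow.continuousOn_transport (hX : IsFlow R (gradient f) X) {h : E d → ℝ → ℝ}
    (hh : Continuous fun p : ℝ≥0 × ball (0 : E d) R => h p.2 p.1) {x : E d} (hx : x ∈ ball 0 R)
    (t : ℝ) : ContinuousOn (fun s => h (X (t - s) x) s) (Icc 0 t) := by
  refine ((hX.continuous_transport hh hx).comp (f := fun s : ℝ => (s, t - s))
    (by fun_prop)).continuousOn.congr fun s hs => ?_
  simp only [Function.comp_apply, Real.coe_toNNReal _ hs.1, Real.coe_toNNReal _ (sub_nonneg.2 hs.2)]

/-- A solution of the transport equation is given by Duhamel's formula. -/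
theorem IsSolution.eq_duhamel (hX : IsFlow R (gradient f) X) {h : E d → ℝ → ℝ}
    (hh : Continuous fun p : ℝ≥0 × ball (0 : E d) R => h p.2 p.1) {v₀ : E d → ℝ} {v : E d → ℝ → ℝ}
    (hv : IsSolution R f h v₀ v) {x : E d} (hx : x ∈ ball 0 R) {t : ℝ} (ht : 0 ≤ t) :
    v x t = v₀ (X t x) + ∫ s in (0 : ℝ)..t, h (X (t - s) x) s := by
  have hpath : ContinuousOn (fun s => (X (t - s) x, s)) (Icc 0 t) :=
    ((hX.continuousOn_time hx).comp (f := fun s => t - s) (by fun_prop)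
      fun s hs => sub_nonneg.2 hs.2).prodMk continuousOn_id
  have hcont : ContinuousOn (fun s => v (X (t - s) x) s) (Icc 0 t) :=
    hv.continuousOn.comp (f := fun s => (X (t - s) x, s)) hpath
      fun s hs => ⟨hX.mem x hx _ (sub_nonneg.2 hs.2), hs.1⟩
  -- Along the reversed characteristic `s ↦ (X_{t-s} x, s)` the transport term cancels and only the
  -- source `h` remains. Joint differentiability of `v` justifies the chain rule.
  have hder : ∀ s ∈ Ioo 0 t, HasDerivAt (fun s => v (X (t - s) x) s) (h (X (t - s) x) s) s := by
    intro s hs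
    have hst : 0 < t - s := sub_pos.2 hs.2
    set y := X (t - s) x with hy
    have hyb : y ∈ ball 0 R := hX.mem x hx _ hst.le
    have hXd : HasDerivAt (fun s => X (t - s) x) (gradient f y) s := by
      have h1 := (hX.deriv x hx _ hst.le).hasDerivAt (Ici_mem_nhds hst)
      have h2 : HasDerivAt (fun s : ℝ => t - s) (-1) s := (hasDerivAt_id s).const_sub t
      have h3 := h1.scomp s h2
      rw [neg_smul, one_smul, neg_neg] at h3
      exact h3
    have hvd : DifferentiableAt ℝ (fun p : E d × ℝ => v p.1 p.2) (y, s) :=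
      hv.differentiableOn.differentiableAt ((isOpen_ball.prod isOpen_Ioi).mem_nhds ⟨hyb, hs.1⟩)
    set L := fderiv ℝ (fun p : E d × ℝ => v p.1 p.2) (y, s)
    have h1 : HasDerivAt (fun s => v (X (t - s) x) s) (L (gradient f y, 1)) s :=
      HasFDerivAt.comp_hasDerivAt (l := fun p : E d × ℝ => v p.1 p.2)
        (f := fun s => (X (t - s) x, s)) s hvd.hasFDerivAt (hXd.prodMk (hasDerivAt_id s))
    have h2 : HasDerivAt (fun r => v y r) (L (0, 1)) s :=
      HasFDerivAt.comp_hasDerivAt (l := fun p : E d × ℝ => v p.1 p.2)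
        (f := fun r => (y, r)) s hvd.hasFDerivAt ((hasDerivAt_const s y).prodMk (hasDerivAt_id s))
    have h3 : HasFDerivAt (fun z => v z s) (L.comp (ContinuousLinearMap.inl ℝ (E d) ℝ)) y :=
      HasFDerivAt.comp (g := fun p : E d × ℝ => v p.1 p.2) (f := fun z => (z, s)) y
        hvd.hasFDerivAt (hasFDerivAt_prodMk_left y s)
    have h4 := hv.equation y hyb s hs.1
    rw [h2.deriv, opL1_eq, h3.fderiv] at h4
    refine h1.congr_deriv ?_
    have h5 : L (gradient f y, 1) = L (gradient f y, 0) + L (0, 1) := by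
      rw [← map_add]; simp
    rw [h5, h4]
    simp
  have key := intervalIntegral.integral_eq_sub_of_hasDerivAt_of_le ht hcont hder
    (by
      have := hX.continuousOn_transport hh hx t
      rw [← uIcc_of_le ht] at this
      exact this.intervalIntegrable)
  rw [key]
  simp only [sub_self, sub_zero, hX.init x hx]
  rw [hv.initial _ (hX.mem x hx t ht)]
  ring

section Duhamel

variable {h : E d → ℝ → ℝ} {v₀ : E d → ℝ} {u : E d → ℝ → ℝ}

/-- Restarting at time `t` gives `u(x,r) = u(X_{r-t} x, t) + ∫ₜʳ h(X_{r-s} x, s) ds` for `r ≥ t`.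
Since the flow runs only forward, this yields a right derivative. -/
theorem hasDerivWithinAt_duhamel (hX : IsFlow R (gradient f) X)
    (hg : IsMonotoneField γ R (gradient f))
    (hud : ∀ t : ℝ≥0, ∀ x ∈ ball (0 : E d) R, DifferentiableAt ℝ (fun y => u y t) x)
    (hh : Continuous fun p : ℝ≥0 × ball (0 : E d) R => h p.2 p.1)
    (hu : ∀ x ∈ ball (0 : E d) R, ∀ t, 0 ≤ t →
      u x t = v₀ (X t x) + ∫ s in (0 : ℝ)..t, h (X (t - s) x) s)
    {x : E d} (hx : x ∈ ball 0 R) {t : ℝ} (ht : 0 ≤ t) :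
    HasDerivWithinAt (fun s => u x s) (opL1 f (fun y => u y t) x + h x t) (Ici t) t := by
  have hint : ∀ y ∈ ball (0 : E d) R, ∀ r a b : ℝ, 0 ≤ a → a ≤ b → b ≤ r →
      IntervalIntegrable (fun s => h (X (r - s) y) s) volume a b := fun y hy r a b ha hab hb => by
    refine ContinuousOn.intervalIntegrable ((hX.continuousOn_transport hh hy r).mono ?_)
    rw [uIcc_of_le hab]
    exact Icc_subset_Icc ha hb
  have hsplit : ∀ r ∈ Ici t, u x r = u (X (r - t) x) t + ∫ s in t..r, h (X (r - s) x) s := by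
    intro r (hr : t ≤ r)
    have hrt : 0 ≤ r - t := sub_nonneg.2 hr
    have hy := hX.mem x hx _ hrt
    rw [hu x hx r (ht.trans hr), hu _ hy t ht, ← hX.add hg hx hrt ht, add_sub_cancel, add_assoc,
      ← intervalIntegral.integral_add_adjacent_intervals (hint x hx r 0 t le_rfl ht hr)
        (hint x hx r t r ht hr le_rfl)]
    congr 2
    refine intervalIntegral.integral_congr fun s hs => ?_
    rw [uIcc_of_le ht] at hs
    rw [← hX.add hg hx hrt (sub_nonneg.2 hs.2)]
    congr 2
    ring
  have h1 : HasDerivWithinAt (fun r => u (X (r - t) x) t) (opL1 f (fun y => u y t) x) (Ici t) t := by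
    have hXd := hX.deriv x hx 0 le_rfl
    have hsub : HasDerivWithinAt (fun r : ℝ => r - t) 1 (Ici t) t :=
      ((hasDerivAt_id t).sub_const t).hasDerivWithinAt
    have hXd' : HasDerivWithinAt (fun r => X (r - t) x) (-gradient f x) (Ici t) t := by
      have := HasDerivWithinAt.scomp (g₁ := fun s => X s x) (h := fun r => r - t) t
        (by rw [sub_self]; exact hXd) hsub (fun r (hr : t ≤ r) => sub_nonneg.2 hr)
      simpa [Function.comp_def, hX.init x hx] using this
    have hud' := (hud ⟨t, ht⟩ x hx).hasFDerivAt
    have hx0 : X (t - t) x = x := by rw [sub_self, hX.init x hx]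
    rw [← hx0] at hud'
    have := hud'.comp_hasDerivWithinAt t hXd'
    rw [hx0, map_neg] at this
    rw [opL1_eq]
    exact this
  have h2 : HasDerivWithinAt (fun r => ∫ s in t..r, h (X (r - s) x) s) (h x t) (Ici t) t := by
    rw [hasDerivWithinAt_iff_isLittleO, Asymptotics.isLittleO_iff]
    intro δ hδ
    -- For `t ≤ s ≤ r` with `r` near `t`, the pair `(s, r - s)` is near `(t, 0)`, so the integrand
    -- is close to `h x t`.
    have hc := (hX.continuous_transport hh hx).tendsto (t, 0)
    have hval : h (X ((0 : ℝ).toNNReal : ℝ) x) ((t.toNNReal : ℝ≥0) : ℝ) = h x t := by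
      simp [ht, hX.init x hx]
    simp only [hval] at hc
    obtain ⟨η, hη, hη'⟩ := Metric.tendsto_nhds_nhds.1 hc δ hδ
    filter_upwards [self_mem_nhdsWithin, mem_nhdsWithin_of_mem_nhds (ball_mem_nhds t hη)]
      with r (hr : t ≤ r) hrη
    rw [mem_ball, Real.dist_eq, abs_of_nonneg (sub_nonneg.2 hr)] at hrη
    have e : (∫ s in t..r, h (X (r - s) x) s) - (∫ s in t..t, h (X (t - s) x) s) - (r - t) • h x t
        = ∫ s in t..r, (h (X (r - s) x) s - h x t) := by
      rw [intervalIntegral.integral_same, sub_zero, intervalIntegral.integral_sub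
        (hint x hx r t r ht hr le_rfl) (by simp), intervalIntegral.integral_const]
    rw [e, Real.norm_eq_abs (r - t)]
    refine intervalIntegral.norm_integral_le_of_norm_le_const fun s hs => ?_
    rw [uIoc_of_le hr] at hs
    have hs0 : 0 ≤ s := ht.trans hs.1.le
    have := hη' (x := (s, r - s)) (by
      rw [Prod.dist_eq, Real.dist_eq, Real.dist_eq, sub_zero, max_lt_iff,
        abs_of_nonneg (sub_nonneg.2 hs.1.le), abs_of_nonneg (sub_nonneg.2 hs.2)]
      constructor <;> linarith [hs.1, hs.2])
    rw [dist_eq_norm] at this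
    simp only [Real.coe_toNNReal _ hs0, Real.coe_toNNReal _ (sub_nonneg.2 hs.2)] at this
    exact this.le
  refine (h1.add h2).congr (fun r hr => hsplit r hr) ?_
  exact hsplit t self_mem_Ici

/-- Duhamel's formula gives a solution of the transport equation. -/
theorem isSolution_duhamel (hX : IsFlow R (gradient f) X) (hg : IsMonotoneField γ R (gradient f))
    (huc : Continuous fun p : ℝ≥0 × ball (0 : E d) R => u p.2 p.1)
    (hud : ∀ t : ℝ≥0, ∀ x ∈ ball (0 : E d) R, DifferentiableAt ℝ (fun y => u y t) x)
    (hud' : Continuous fun p : ℝ≥0 × ball (0 : E d) R => fderiv ℝ (fun y => u y p.1) p.2)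
    (hh : Continuous fun p : ℝ≥0 × ball (0 : E d) R => h p.2 p.1)
    (hu : ∀ x ∈ ball (0 : E d) R, ∀ t, 0 ≤ t →
      u x t = v₀ (X t x) + ∫ s in (0 : ℝ)..t, h (X (t - s) x) s) :
    IsSolution R f h v₀ u := by
  set D : E d → ℝ → ℝ := fun x t => opL1 f (fun y => u y t) x + h x t with hD
  have hgc : Continuous (gradient f) := hg.contDiff.continuous
  have hDc : Continuous fun p : ℝ≥0 × ball (0 : E d) R => D p.2 p.1 := by
    simp only [hD, opL1_eq]
    exact (hud'.clm_apply (hgc.comp (continuous_subtype_val.comp continuous_snd))).neg.add hh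
  have hright := fun {x} hx {t} ht =>
    hasDerivWithinAt_duhamel (x := x) (t := t) hX hg hud hh hu hx ht
  have hDx : ∀ x ∈ ball (0 : E d) R, Continuous fun s : ℝ => D x s.toNNReal := fun x hx =>
    hDc.comp (f := fun s : ℝ => (s.toNNReal, (⟨x, hx⟩ : ball (0 : E d) R))) (by fun_prop)
  have hucx : ∀ x ∈ ball (0 : E d) R, ContinuousOn (fun s => u x s) (Ici 0) := fun x hx =>
    (continuousOn_ball_Ici huc).comp (f := fun s => (x, s)) (by fun_prop) fun s hs => ⟨hx, hs⟩
  -- A continuous function with a continuous right derivative is the integral of it, and so has a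
  -- two-sided derivative at positive times.
  have hderiv : ∀ x ∈ ball (0 : E d) R, ∀ t, 0 < t → HasDerivAt (fun s => u x s) (D x t) t := by
    intro x hx t ht
    have hftc : ∀ T, 0 ≤ T → u x T = u x 0 + ∫ s in (0 : ℝ)..T, D x s.toNNReal := by
      intro T hT
      rw [intervalIntegral.integral_eq_sub_of_hasDeriv_right (f := fun s => u x s)]
      · ring
      · rw [uIcc_of_le hT]
        exact (hucx x hx).mono fun s hs => hs.1
      · intro s hs
        rw [min_eq_left hT, max_eq_right hT] at hs
        rw [Real.coe_toNNReal _ hs.1.le]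
        exact (hright hx hs.1.le).mono Ioi_subset_Ici_self
      · exact (hDx x hx).intervalIntegrable _ _
    have h1 := ((hDx x hx).integral_hasStrictDerivAt 0 t).hasDerivAt.const_add (u x 0)
    rw [Real.coe_toNNReal _ ht.le] at h1
    refine h1.congr_of_eventuallyEq ?_
    filter_upwards [Ioi_mem_nhds ht] with T hT using hftc T (le_of_lt hT)
  refine ⟨continuousOn_ball_Ici huc, ?_, ?_, ?_⟩
  · rintro ⟨x, t⟩ ⟨hx, ht⟩
    refine DifferentiableAt.differentiableWithinAt ?_
    have hnhds : ball (0 : E d) R ×ˢ Ioi (0 : ℝ) ∈ 𝓝 (x, t) :=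
      (isOpen_ball.prod isOpen_Ioi).mem_nhds ⟨hx, ht⟩
    have hnhds' : ball (0 : E d) R ×ˢ Ici (0 : ℝ) ∈ 𝓝 (x, t) :=
      Filter.mem_of_superset hnhds (prod_mono_right Ioi_subset_Ici_self)
    -- Continuous partial derivatives in space and in time give joint differentiability.
    refine (hasStrictFDerivAt_uncurry_coprod (f := u)
      (f₁ := fun y s => fderiv ℝ (fun z => u z s) y)
      (f₂ := fun y s => ContinuousLinearMap.toSpanSingleton ℝ (D y s)) ?_ ?_ ?_ ?_).hasFDerivAt.differentiableAt
    · filter_upwards [hnhds] with p hp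
      exact (hud ⟨p.2, le_of_lt hp.2⟩ p.1 hp.1).hasFDerivAt
    · filter_upwards [hnhds] with p hp
      exact (hderiv p.1 hp.1 p.2 hp.2).hasFDerivAt
    · exact (continuousOn_ball_Ici (G := fun y s => fderiv ℝ (fun z => u z s) y) hud').continuousAt
        hnhds'
    · exact (continuousOn_ball_Ici (G := fun y s => ContinuousLinearMap.toSpanSingleton ℝ (D y s))
        ((ContinuousLinearMap.toSpanSingletonCLE (𝕜 := ℝ) (E := ℝ)).continuous.comp hDc)).continuousAt hnhds'
  · intro x hx
    rw [hu x hx 0 le_rfl, hX.init x hx, intervalIntegral.integral_same, add_zero]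
  · intro x hx t ht
    exact (hderiv x hx t ht).deriv

end Duhamel

end Solutions

/-! ### Translation between `C^k` norms and `PolyBdd`. -/

section Regularity

variable {d : ℕ} {R : ℝ} {V : Type} [NormedAddCommGroup V] [NormedSpace ℝ V]

theorem IsCk.norm_iteratedFDeriv_le {k : ℕ} {g : E d → V} (h : IsCk k R g) {j : ℕ} (hj : j ≤ k)
    {x : E d} (hx : x ∈ ball 0 R) : ‖iteratedFDeriv ℝ j g x‖ ≤ normCk k R g :=
  le_csSup h.2 ⟨j, hj, x, hx, rfl⟩

theorem normCk_nonneg (k : ℕ) (R : ℝ) (g : E d → V) : 0 ≤ normCk k R g :=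
  Real.sSup_nonneg fun _ ⟨_, _, _, _, h⟩ => h ▸ norm_nonneg _

theorem isCk_of_contDiff {k : ℕ} {g : E d → V} (h : ContDiff ℝ k g) : IsCk k R g := by
  refine ⟨h.contDiffOn, ?_⟩
  have hb : ∀ j : ℕ, ∃ C, j ≤ k → ∀ x ∈ closedBall (0 : E d) R, ‖iteratedFDeriv ℝ j g x‖ ≤ C := by
    intro j
    by_cases hj : j ≤ k
    · obtain ⟨C, hC⟩ := (isCompact_closedBall (0 : E d) R).exists_bound_of_continuousOn
        (h.continuous_iteratedFDeriv (m := j) (by exact_mod_cast hj)).continuousOn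
      exact ⟨C, fun _ => hC⟩
    · exact ⟨0, fun h => absurd h hj⟩
  choose C hC using hb
  refine ⟨∑ j ∈ Finset.range (k + 1), |C j|, ?_⟩
  rintro r ⟨j, hj, x, hx, rfl⟩
  refine (hC j hj x (ball_subset_closedBall hx)).trans ((le_abs_self _).trans ?_)
  exact Finset.single_le_sum (f := fun j => |C j|) (fun _ _ => abs_nonneg _)
    (Finset.mem_range.2 (by omega))

variable {ι T : Type} [TopologicalSpace T] {M : ι → ℝ} {w : T → ℝ}

theorem polyBdd_of_norm_iteratedFDeriv_le {k : ℕ} {a : ι → E d → V}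
    (h : ∀ i, ContDiffOn ℝ k (a i) (ball 0 R))
    (hM : ∀ i, ∀ j ≤ k, ∀ x ∈ ball (0 : E d) R, ‖iteratedFDeriv ℝ j (a i) x‖ ≤ M i) :
    PolyBdd R M (fun _ : Unit => 1) k fun i _ => a i := by
  have hu : UnifBdd R M (fun _ : Unit => 1) fun i _ => a i := by
    refine ⟨fun i => ?_, 1, fun i _ x hx => ?_⟩
    · exact (continuousOn_iff_continuous_domRestrict.1 (h i).continuousOn).comp continuous_snd
    · simpa using hM i 0 (Nat.zero_le _) x hx
  induction k generalizing V with
  | zero => exact hu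
  | succ k ih =>
    have hs := fun i => (contDiffOn_succ_iff_fderiv_of_isOpen isOpen_ball).1
      (by exact_mod_cast h i : ContDiffOn ℝ ((k : WithTop ℕ∞) + 1) (a i) (ball 0 R))
    have h' : ∀ i, ContDiffOn ℝ k (fderiv ℝ (a i)) (ball 0 R) := fun i => (hs i).2.2
    have hM' : ∀ i, ∀ j ≤ k, ∀ x ∈ ball (0 : E d) R, ‖iteratedFDeriv ℝ j (fderiv ℝ (a i)) x‖ ≤ M i :=
      fun i j hj x hx => by
        rw [norm_iteratedFDeriv_fderiv]
        exact hM i (j + 1) (by omega) x hx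
    refine ⟨hu, fun i _ x hx => (hs i).1.differentiableAt (isOpen_ball.mem_nhds hx),
      ih h' hM' ⟨fun i => ?_, 1, fun i _ x hx => ?_⟩⟩
    · exact (continuousOn_iff_continuous_domRestrict.1 (h' i).continuousOn).comp continuous_snd
    · simpa using hM' i 0 (Nat.zero_le _) x hx

theorem polyBdd_of_isCk {k : ℕ} {a : ι → E d → V} (h : ∀ i, IsCk k R (a i))
    (hM : ∀ i, normCk k R (a i) ≤ M i) : PolyBdd R M (fun _ : Unit => 1) k fun i _ => a i :=
  polyBdd_of_norm_iteratedFDeriv_le (fun i => (h i).1) fun i _ hj _ hx =>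
    ((h i).norm_iteratedFDeriv_le hj hx).trans (hM i)

theorem PolyBdd.contDiffOn {k : ℕ} {G : ι → T → E d → V} (h : PolyBdd R M w k G) (i : ι) (τ : T) :
    ContDiffOn ℝ k (G i τ) (ball 0 R) := by
  induction k generalizing V with
  | zero =>
    rw [Nat.cast_zero, contDiffOn_zero, continuousOn_iff_continuous_domRestrict]
    exact (h.1 i).comp (continuous_const.prodMk continuous_id)
  | succ k ih =>
    rw [Nat.cast_succ, contDiffOn_succ_iff_fderiv_of_isOpen isOpen_ball]
    exact ⟨fun x hx => (h.2.1 i τ x hx).differentiableWithinAt, by simp, ih h.2.2⟩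

theorem PolyBdd.norm_iteratedFDeriv_le {k : ℕ} {G : ι → T → E d → V} (h : PolyBdd R M w k G) :
    ∃ m : ℕ, ∀ i τ, ∀ x ∈ ball (0 : E d) R, ‖iteratedFDeriv ℝ k (G i τ) x‖ ≤ M i ^ m * w τ := by
  induction k generalizing V with
  | zero => simpa using h.2
  | succ k ih => simpa only [norm_iteratedFDeriv_fderiv] using ih h.2.2

theorem abs_partialD_le {k : ℕ} (J : Fin k → Fin d) (v : E d → ℝ) (x : E d) :
    |partialD J v x| ≤ ‖iteratedFDeriv ℝ k v x‖ := by
  refine ((iteratedFDeriv ℝ k v x).le_opNorm _).trans ?_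
  simp

theorem iteratedFDeriv_eq_of_eqOn_ball {F F' : E d → V} (h : EqOn F F' (ball 0 R)) (k : ℕ) {x : E d}
    (hx : x ∈ ball 0 R) : iteratedFDeriv ℝ k F x = iteratedFDeriv ℝ k F' x := by
  have : F =ᶠ[𝓝 x] F' := by filter_upwards [isOpen_ball.mem_nhds hx] with y hy using h hy
  exact (this.iteratedFDeriv ℝ k).eq_of_nhds

end Regularity

/-! ### Strong monotonicity of the averaged gradient. -/

section Monotone

variable {d : ℕ} {γ R : ℝ}

/-- On the segment from `y` to `x` the function `F - γ/2‖·‖²` is convex in one variable, so its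
slope at the start is at most its slope at the end. -/
theorem mul_sq_le_inner_gradient_of_strongConvexOn {F : E d → ℝ} (hF : Differentiable ℝ F)
    (h : StrongConvexOn (ball 0 R) γ F) {x y : E d} (hx : x ∈ ball 0 R) (hy : y ∈ ball 0 R) :
    γ * ‖x - y‖ ^ 2 ≤ inner ℝ (gradient F x - gradient F y) (x - y) := by
  have hconv := (strongConvexOn_iff_convex.1 h).comp_affineMap (AffineMap.lineMap (k := ℝ) y x)
  set ψ := (fun z => F z - γ / (2 : ℝ) * ‖z‖ ^ 2) ∘ (AffineMap.lineMap (k := ℝ) y x) with hψ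
  have hd : ∀ t : ℝ, HasDerivAt ψ (fderiv ℝ F (AffineMap.lineMap y x t) (x - y)
      - γ / 2 * (2 * inner ℝ (AffineMap.lineMap y x t) (x - y))) t := fun t => by
    have hl : HasDerivAt (fun t : ℝ => AffineMap.lineMap (k := ℝ) y x t) (x - y) t :=
      AffineMap.hasDerivAt_lineMap
    exact ((hF _).hasFDerivAt.comp_hasDerivAt t hl).sub (hl.norm_sq.const_mul (γ / 2))
  have h0 : (0 : ℝ) ∈ (AffineMap.lineMap (k := ℝ) y x) ⁻¹' ball 0 R := by simpa using hy
  have h1 : (1 : ℝ) ∈ (AffineMap.lineMap (k := ℝ) y x) ⁻¹' ball 0 R := by simpa using hx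
  have hle := (hconv.le_slope_of_hasDerivAt h0 h1 one_pos (hd 0)).trans
    (hconv.slope_le_of_hasDerivAt h0 h1 one_pos (hd 1))
  simp only [AffineMap.lineMap_apply_zero, AffineMap.lineMap_apply_one] at hle
  have e1 : ∀ z, inner ℝ (gradient F z) (x - y) = fderiv ℝ F z (x - y) := fun z => by
    rw [gradient, InnerProductSpace.toDual_symm_apply]
  rw [inner_sub_left, e1, e1, ← real_inner_self_eq_norm_sq, inner_sub_left]
  linarith

/-- The monotonicity inequality is linear in the gradient, so it survives integration over `ξ`;
unbiasedness turns the mean into `∇f`. -/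
theorem Assumptions.isMonotoneField {Ξ : Type*} [MeasurableSpace Ξ] {μ : Measure Ξ}
    {F : Ξ → E d → ℝ} {f : E d → ℝ} {b R₁ : ℝ} (h : Assumptions μ F f γ b R₁) (hR : R ≤ R₁) :
    IsMonotoneField γ R (gradient f) := by
  have := h.isProbabilityMeasure
  refine ⟨?_, ?_, fun x hx y hy => ?_⟩
  · exact (riesz d).contDiff.comp (h.contDiff.fderiv_right (m := 2) (by norm_num))
  · rw [gradient, h.isLocalMin.fderiv_eq_zero, map_zero]
  have hint : ∀ z, Integrable (fun ξ => gradient (F ξ) z) μ := fun z =>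
    (h.memLp z).integrable one_le_two
  have hle : ∀ ξ, γ * ‖x - y‖ ^ 2 ≤ inner ℝ (x - y) (gradient (F ξ) x - gradient (F ξ) y) :=
    fun ξ => by
      rw [real_inner_comm]
      exact mul_sq_le_inner_gradient_of_strongConvexOn
        ((h.contDiff_sample ξ).differentiable (by norm_num)) (h.strongConvexOn ξ)
        (ball_subset_ball hR hx)        (ball_subset_ball hR hy)
  have hI := integral_inner (𝕜 := ℝ) ((hint x).sub (hint y)) (x - y)
  have hmono := integral_mono (integrable_const _) (((hint x).sub (hint y)).const_inner (x - y)) hle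
  simp only [Pi.sub_apply] at hI
  rw [integral_const, probReal_univ, one_smul] at hmono
  rw [← h.unbiased x, ← h.unbiased y, real_inner_comm, ← integral_sub (hint x) (hint y)]
  exact hmono.trans_eq hI

end Monotone

/-! ### Counting derivatives through the recursion. -/

section CoeffFamily

variable {d : ℕ} {ι : Type} {R γ c : ℝ} {M : ι → ℝ}
variable {f φ : ι → E d → ℝ} {S : ι → E d → Fin d → Fin d → ℝ} {X : ι → ℝ → E d → E d}

/-- Every application of `𝓛₂` costs two derivatives, so `2 * (n - l)` spare ones are kept at stage
`l`. The covariance enters only if `n ≠ 0`, where also the truncated subtraction in its order is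
harmless. -/
theorem coeffFun_polyBdd (hM : ∀ i, 2 ≤ M i) (hγ : 0 < γ) (hc : c < γ)
    (hg : ∀ i, IsMonotoneField γ R (gradient (f i))) (hX : ∀ i, IsFlow R (gradient (f i)) (X i))
    (k n : ℕ) (hf : PolyBdd R M (fun _ : Unit => 1) (k + 1 + 2 * n) fun i _ => fderiv ℝ (f i))
    (hφ : PolyBdd R M (fun _ : Unit => 1) (k + 1 + 2 * n) fun i _ => φ i)
    (hS : n ≠ 0 → PolyBdd R M (fun _ : Unit => 1) (k + 2 * n - 1) fun i _ => S i) (l : ℕ)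
    (hl : l ≤ n) :
    (∃ W, PolyBdd R M W (k + 1 + 2 * (n - l))
      (fun i (t : ℝ≥0) => coeffFun (f i) (S i) (φ i) (X i) l t)) ∧
    PolyBdd R M (expWeight c) (k + 2 * (n - l))
      (fun i (t : ℝ≥0) => fderiv ℝ (coeffFun (f i) (S i) (φ i) (X i) l t)) := by
  have hXk : PolyBdd R M (expWeight γ) (k + 2 * n + 1) fun i (t : ℝ≥0) => X i t := by
    refine IsFlow.polyBdd hM hγ hg hX ?_
    exact ((hf.of_le (by omega) : PolyBdd R M _ (k + 2 * n + 1) _).clm hM (riesz d)).2.2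
  induction l with
  | zero =>
    have h := coeffFun_zero_polyBdd (S := S) hM hγ hX hXk
      (hφ.of_le (by omega) : PolyBdd R M _ (k + 2 * n + 1) _)
    exact ⟨⟨_, h.1.of_le (by omega)⟩, (h.2.weight_mono hM 1 (expWeight_nonneg c) fun t => by
      rw [one_mul]; exact expWeight_anti hc.le t).of_le (by omega)⟩
  | succ l ih =>
    have h := coeffFun_succ_polyBdd (k := k + 2 * (n - (l + 1))) hM hγ hc hX
      (hXk.of_le (by omega)) (hf.of_le (by omega)) ((hS (by omega)).of_le (by omega))
      ((ih (by omega)).2.of_le (by omega))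
    exact ⟨h.1.imp fun W hW => hW.of_le (by omega), h.2⟩

theorem opL2_coeffFun_unifBdd (hM : ∀ i, 2 ≤ M i) (hγ : 0 < γ) (hc : c < γ)
    (hg : ∀ i, IsMonotoneField γ R (gradient (f i))) (hX : ∀ i, IsFlow R (gradient (f i)) (X i))
    (k n : ℕ) (hf : PolyBdd R M (fun _ : Unit => 1) (k + 1 + 2 * n) fun i _ => fderiv ℝ (f i))
    (hφ : PolyBdd R M (fun _ : Unit => 1) (k + 1 + 2 * n) fun i _ => φ i)
    (hS : n ≠ 0 → PolyBdd R M (fun _ : Unit => 1) (k + 2 * n - 1) fun i _ => S i) (l : ℕ)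
    (hl : l < n) :
    UnifBdd R M (expWeight c)
      (fun i (t : ℝ≥0) => opL2 (f i) (S i) (coeffFun (f i) (S i) (φ i) (X i) l t)) :=
  (PolyBdd.opL2 (k := 0) hM (expWeight_nonneg c) (hf.of_le (by omega))
    ((hS (by omega)).of_le (by omega))
    ((coeffFun_polyBdd hM hγ hc hg hX k n hf hφ hS l hl.le).2.of_le (by omega))).unifBdd

end CoeffFamily

/-! ### Existence and uniqueness of the coefficients of one datum. -/

section SingleCoeffs

variable {d : ℕ} {R γ : ℝ} {f φ : E d → ℝ} {S : E d → Fin d → Fin d → ℝ} {X : ℝ → E d → E d}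

theorem isCoeffs_coeffFun (hX : IsFlow R (gradient f) X) (hg : IsMonotoneField γ R (gradient f))
    {n : ℕ}
    (hc : ∀ l ≤ n, Continuous fun p : ℝ≥0 × ball (0 : E d) R => coeffFun f S φ X l p.1 p.2)
    (hd : ∀ l ≤ n, ∀ t : ℝ≥0, ∀ x ∈ ball (0 : E d) R, DifferentiableAt ℝ (coeffFun f S φ X l t) x)
    (hd' : ∀ l ≤ n,
      Continuous fun p : ℝ≥0 × ball (0 : E d) R => fderiv ℝ (coeffFun f S φ X l p.1) p.2)
    (hh : ∀ l < n,
      Continuous fun p : ℝ≥0 × ball (0 : E d) R => opL2 f S (coeffFun f S φ X l p.1) p.2) :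
    IsCoeffs R f S φ n fun l x t => coeffFun f S φ X l t x where
  zero := isSolution_duhamel hX hg (hc 0 (Nat.zero_le _)) (hd 0 (Nat.zero_le _))
    (hd' 0 (Nat.zero_le _)) continuous_const fun x _ t _ => by simp [coeffFun]
  succ l hl := isSolution_duhamel hX hg (hc (l + 1) hl) (hd (l + 1) hl) (hd' (l + 1) hl) (hh l hl)
    fun x _ t _ => by simp [coeffFun]

theorem IsCoeffs.eq_coeffFun (hX : IsFlow R (gradient f) X) {n : ℕ}
    (hh : ∀ l < n,
      Continuous fun p : ℝ≥0 × ball (0 : E d) R => opL2 f S (coeffFun f S φ X l p.1) p.2)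
    {u : ℕ → E d → ℝ → ℝ} (hu : IsCoeffs R f S φ n u) {l : ℕ} (hl : l ≤ n) {t : ℝ} (ht : 0 ≤ t) :
    EqOn (fun x => u l x t) (coeffFun f S φ X l t) (ball 0 R) := by
  induction l generalizing t with
  | zero =>
    intro x hx
    have := hu.zero.eq_duhamel hX continuous_const hx ht
    simpa [coeffFun] using this
  | succ l ih =>
    intro x hx
    have hopL2 : ∀ s, 0 ≤ s → EqOn (opL2 f S fun y => u l y s) (opL2 f S (coeffFun f S φ X l s))
        (ball 0 R) := fun s hs => opL2_congr (ih (by omega) hs)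
    have hcont : Continuous fun p : ℝ≥0 × ball (0 : E d) R =>
        opL2 f S (fun y => u l y p.1) p.2 :=
      (hh l hl).congr fun p => (hopL2 p.1 p.1.coe_nonneg p.2.2).symm
    have := (hu.succ l hl).eq_duhamel hX hcont hx ht
    rw [zero_add] at this
    refine this.trans (intervalIntegral.integral_congr fun s hs => ?_)
    rw [uIcc_of_le ht] at hs
    exact hopL2 s hs.1 (hX.mem x hx _ (sub_nonneg.2 hs.2))

end SingleCoeffs

/-- An objective, a covariance and a test function with bounded derivatives up to the orders `b`,
`s` and `a` respectively. -/
structure Datum (d : ℕ) (γ R : ℝ) (n a b s : ℕ) where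
  f : E d → ℝ
  S : E d → Fin d → Fin d → ℝ
  φ : E d → ℝ
  isMonotoneField : IsMonotoneField γ R (gradient f)
  isCk_φ : IsCk a R φ
  isCk_f : IsCk b R f
  isCk_S : n ≠ 0 → IsCk s R S

/-! ### Uniformity over all admissible data at once. -/

namespace Datum

variable {d : ℕ} {γ R c : ℝ} {n a b s k : ℕ}

/-- The size of the datum; the covariance is ignored if `n = 0`. -/
noncomputable def size (i : Datum d γ R n a b s) : ℝ :=
  2 + normCk a R i.φ + normCk b R i.f + if n = 0 then 0 else normCk s R i.S

theorem two_le_size (i : Datum d γ R n a b s) : 2 ≤ i.size := by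
  have h1 := normCk_nonneg a R i.φ
  have h2 := normCk_nonneg b R i.f
  have h3 := normCk_nonneg s R i.S
  unfold size
  split_ifs <;> linarith

theorem polyBdd_φ : PolyBdd R (size : Datum d γ R n a b s → ℝ) (fun _ : Unit => 1) a
    fun i _ => i.φ := polyBdd_of_isCk (fun i => i.isCk_φ) fun i => by
  have h2 := normCk_nonneg b R i.f
  have h3 := normCk_nonneg s R i.S
  unfold size
  split_ifs <;> linarith

theorem polyBdd_f : PolyBdd R (size : Datum d γ R n a b s → ℝ) (fun _ : Unit => 1) b
    fun i _ => i.f := polyBdd_of_isCk (fun i => i.isCk_f) fun i => by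
  have h1 := normCk_nonneg a R i.φ
  have h3 := normCk_nonneg s R i.S
  unfold size
  split_ifs <;> linarith

theorem polyBdd_S (hn : n ≠ 0) : PolyBdd R (size : Datum d γ R n a b s → ℝ) (fun _ : Unit => 1) s
    fun i _ => i.S := polyBdd_of_isCk (fun i => i.isCk_S hn) fun i => by
  have h1 := normCk_nonneg a R i.φ
  have h2 := normCk_nonneg b R i.f
  unfold size
  rw [if_neg hn]
  linarith

theorem exists_flow (hγ : 0 < γ) : ∃ X : Datum d γ R n a b s → ℝ → E d → E d,
    ∀ i, IsFlow R (gradient i.f) (X i) := by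
  choose X hX using fun i : Datum d γ R n a b s => i.isMonotoneField.exists_flow hγ
  exact ⟨X, hX⟩

variable {X : Datum d γ R n a b s → ℝ → E d → E d}

theorem coeffFun_polyBdd (hγ : 0 < γ) (hX : ∀ i, IsFlow R (gradient i.f) (X i))
    (hc : c < γ) (ha : k + 1 + 2 * n ≤ a) (hb : k + 2 + 2 * n ≤ b)
    (hs : n ≠ 0 → k + 2 * n - 1 ≤ s) (l : ℕ) (hl : l ≤ n) :
    (∃ W, PolyBdd R size W (k + 1 + 2 * (n - l))
      (fun (i : Datum d γ R n a b s) (t : ℝ≥0) => coeffFun i.f i.S i.φ (X i) l t)) ∧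
    PolyBdd R size (expWeight c) (k + 2 * (n - l))
      (fun (i : Datum d γ R n a b s) (t : ℝ≥0) => fderiv ℝ (coeffFun i.f i.S i.φ (X i) l t)) :=
  SGDExpansion.coeffFun_polyBdd two_le_size hγ hc (fun i => i.isMonotoneField) hX k n
    (polyBdd_f.of_le (by omega) : PolyBdd R size _ (k + 1 + 2 * n + 1) _).2.2
    (polyBdd_φ.of_le ha) (fun hn => (polyBdd_S hn).of_le (hs hn)) l hl

theorem opL2_coeffFun_unifBdd (hγ : 0 < γ) (hX : ∀ i, IsFlow R (gradient i.f) (X i))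
    (hc : c < γ) (ha : k + 1 + 2 * n ≤ a) (hb : k + 2 + 2 * n ≤ b)
    (hs : n ≠ 0 → k + 2 * n - 1 ≤ s) (l : ℕ) (hl : l < n) :
    UnifBdd R size (expWeight c) (fun (i : Datum d γ R n a b s) (t : ℝ≥0) =>
      opL2 i.f i.S (coeffFun i.f i.S i.φ (X i) l t)) :=
  SGDExpansion.opL2_coeffFun_unifBdd two_le_size hγ hc (fun i => i.isMonotoneField) hX k n
    (polyBdd_f.of_le (by omega) : PolyBdd R size _ (k + 1 + 2 * n + 1) _).2.2
    (polyBdd_φ.of_le ha) (fun hn => (polyBdd_S hn).of_le (hs hn)) l hl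

theorem eq_coeffFun (hγ : 0 < γ) (hX : ∀ i, IsFlow R (gradient i.f) (X i))
    (ha : 1 + 2 * n ≤ a) (hb : 2 + 2 * n ≤ b) (hs : n ≠ 0 → 2 * n - 1 ≤ s)
    (i : Datum d γ R n a b s) {u : ℕ → E d → ℝ → ℝ} (hu : IsCoeffs R i.f i.S i.φ n u) {l : ℕ}
    (hl : l ≤ n) {t : ℝ} (ht : 0 ≤ t) :
    EqOn (fun x => u l x t) (coeffFun i.f i.S i.φ (X i) l t) (ball 0 R) :=
  -- Any rate below `γ` would do: only the continuity contained in `UnifBdd` is used.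
  hu.eq_coeffFun (hX i) (fun l hl => (opL2_coeffFun_unifBdd (k := 0) hγ hX (sub_one_lt γ)
    (by omega) (by omega) (fun h => by have := hs h; omega) l hl).1 i) hl ht

theorem exists_isCoeffs (hγ : 0 < γ) (ha : 1 + 2 * n ≤ a) (hb : 2 + 2 * n ≤ b)
    (hs : n ≠ 0 → 2 * n - 1 ≤ s) (i : Datum d γ R n a b s) : ∃ u, IsCoeffs R i.f i.S i.φ n u := by
  obtain ⟨X, hX⟩ := exists_flow (d := d) (γ := γ) (R := R) (n := n) (a := a) (b := b) (s := s) hγ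
  have hU := coeffFun_polyBdd (k := 0) hγ hX (sub_one_lt γ) (by omega) (by omega)
    (fun h => by have := hs h; omega)
  have hL := opL2_coeffFun_unifBdd (k := 0) hγ hX (sub_one_lt γ) (by omega) (by omega)
    (fun h => by have := hs h; omega)
  refine ⟨_, isCoeffs_coeffFun (hX i) i.isMonotoneField (fun l hl => ?_) (fun l hl => ?_)
    (fun l hl => (hU l hl).2.unifBdd.1 i) fun l hl => (hL l hl).1 i⟩
  · obtain ⟨W, hW⟩ := (hU l hl).1
    exact hW.unifBdd.1 i
  · obtain ⟨W, hW⟩ := (hU l hl).1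
    exact (hW.of_le (by omega) : PolyBdd R size W (0 + 1) _).2.1 i

end Datum

/-! ### Convergence of the coefficients and decay of their derivatives. -/

section DecayEstimates

variable {d : ℕ} {R : ℝ}

theorem norm_sub_le_of_norm_fderiv_le {v : E d → ℝ} {C : ℝ}
    (hd : ∀ x ∈ ball (0 : E d) R, DifferentiableAt ℝ v x)
    (hC : ∀ x ∈ ball (0 : E d) R, ‖fderiv ℝ v x‖ ≤ C) {x : E d} (hx : x ∈ ball 0 R) :
    |v x - v 0| ≤ C * ‖x‖ := by
  have h0 : (0 : E d) ∈ ball (0 : E d) R :=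
    mem_ball_self (dist_nonneg.trans_lt (mem_ball.1 hx))
  simpa using (convex_ball (0 : E d) R).norm_image_sub_le_of_norm_fderiv_le hd hC h0 hx

theorem IsCk.abs_sub_le {φ : E d → ℝ} (hφ : IsCk 1 R φ) {x : E d} (hx : x ∈ ball 0 R) :
    |φ x - φ 0| ≤ normCk 1 R φ * ‖x‖ := by
  refine norm_sub_le_of_norm_fderiv_le (fun y hy => ?_) (fun y hy => ?_) hx
  · exact (hφ.1.differentiableOn (by norm_num)).differentiableAt (isOpen_ball.mem_nhds hy)
  · rw [← norm_iteratedFDeriv_one]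
    exact hφ.norm_iteratedFDeriv_le le_rfl hy

theorem PolyBdd.contDiffOn_and_abs_partialD_le {ι T : Type} [TopologicalSpace T] {M : ι → ℝ}
    {W w : T → ℝ} {k : ℕ} {U : ι → T → E d → ℝ} (hU : PolyBdd R M W (k + 1) U)
    (hU' : PolyBdd R M w k fun i t => fderiv ℝ (U i t)) :
    ∃ m : ℕ, ∀ i t v, EqOn v (U i t) (ball 0 R) →
      ContDiffOn ℝ (k + 1 : ℕ) v (ball 0 R) ∧
      ∀ J : Fin (k + 1) → Fin d, ∀ x ∈ ball (0 : E d) R, |partialD J v x| ≤ M i ^ m * w t := by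
  obtain ⟨m, hm⟩ := hU'.norm_iteratedFDeriv_le
  refine ⟨m, fun i t v hv => ⟨(hU.contDiffOn i t).congr hv, fun J x hx => ?_⟩⟩
  refine (abs_partialD_le J v x).trans ?_
  rw [iteratedFDeriv_eq_of_eqOn_ball hv _ hx, ← norm_iteratedFDeriv_fderiv]
  exact hm i t x hx

namespace Datum

variable {γ c : ℝ} {n a b s k : ℕ}

theorem abs_sub_le (hγ : 0 < γ) (i : Datum d γ R 0 1 2 0) {u : ℕ → E d → ℝ → ℝ}
    (hu : IsCoeffs R i.f i.S i.φ 0 u) {t : ℝ} (ht : 0 ≤ t) {x : E d} (hx : x ∈ ball 0 R) :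
    |u 0 x t - i.φ 0| ≤ R * normCk 1 R i.φ * Real.exp (-γ * t) := by
  obtain ⟨X, hX⟩ := exists_flow (d := d) (γ := γ) (R := R) (n := 0) (a := 1) (b := 2) (s := 0) hγ
  have hux : u 0 x t = i.φ (X i t x) :=
    eq_coeffFun hγ hX (by norm_num) (by norm_num) (by simp) i hu le_rfl ht hx
  rw [hux]
  refine (i.isCk_φ.abs_sub_le ((hX i).mem x hx t ht)).trans ?_
  have h1 := (hX i).norm_le i.isMonotoneField hx ht
  have h2 : ‖x‖ ≤ R := (mem_ball_zero_iff.1 hx).le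
  calc normCk 1 R i.φ * ‖X i t x‖ ≤ normCk 1 R i.φ * (Real.exp (-γ * t) * R) := by
        gcongr
        · exact normCk_nonneg _ _ _
        · exact h1.trans (by gcongr)
    _ = R * normCk 1 R i.φ * Real.exp (-γ * t) := by ring

/-- Separate from `exists_partialD_le` because without a source term the exact rate `γ` is reached,
whereas the latter requires `c < γ`. -/
theorem exists_partialD_zero_le (hγ : 0 < γ) (k : ℕ) : ∃ m : ℕ,
    ∀ (i : Datum d γ R 0 (k + 1) (k + 2) 0) (u : ℕ → E d → ℝ → ℝ),
      IsCoeffs R i.f i.S i.φ 0 u → ∀ t ≥ 0,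
        ContDiffOn ℝ (k + 1 : ℕ) (fun y => u 0 y t) (ball 0 R) ∧
        ∀ J : Fin (k + 1) → Fin d, ∀ x ∈ ball (0 : E d) R,
          |partialD J (fun y => u 0 y t) x| ≤ i.size ^ m * Real.exp (-γ * t) := by
  obtain ⟨X, hX⟩ := exists_flow (d := d) (γ := γ) (R := R) (n := 0) (a := k + 1) (b := k + 2)
    (s := 0) hγ
  have hf : PolyBdd R (size : Datum d γ R 0 (k + 1) (k + 2) 0 → ℝ) (fun _ : Unit => 1) (k + 1)
      fun i _ => fderiv ℝ i.f := (polyBdd_f (b := k + 1 + 1)).2.2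
  have hXk : PolyBdd R size (expWeight γ) (k + 1)
      fun (i : Datum d γ R 0 (k + 1) (k + 2) 0) (t : ℝ≥0) => X i t :=
    IsFlow.polyBdd two_le_size hγ (fun i => i.isMonotoneField) hX
      (hf.clm two_le_size (riesz d)).2.2
  have h := coeffFun_zero_polyBdd (S := Datum.S) two_le_size hγ hX hXk polyBdd_φ
  obtain ⟨m, hm⟩ := h.1.contDiffOn_and_abs_partialD_le h.2
  exact ⟨m, fun i u hu t ht => hm i ⟨t, ht⟩ _
    (eq_coeffFun hγ hX (by omega) (by omega) (by simp) i hu le_rfl ht)⟩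

theorem exists_partialD_le (hγ : 0 < γ) (hc : c < γ) (ha : k + 1 + 2 * n ≤ a)
    (hb : k + 2 + 2 * n ≤ b) (hs : k + 2 * n - 1 ≤ s) : ∃ m : ℕ,
    ∀ (i : Datum d γ R n a b s) (u : ℕ → E d → ℝ → ℝ),
      IsCoeffs R i.f i.S i.φ n u → ∀ t ≥ 0,
        ContDiffOn ℝ (k + 1 : ℕ) (fun y => u n y t) (ball 0 R) ∧
        ∀ J : Fin (k + 1) → Fin d, ∀ x ∈ ball (0 : E d) R,
          |partialD J (fun y => u n y t) x| ≤ i.size ^ m * Real.exp (-c * t) := by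
  obtain ⟨X, hX⟩ := exists_flow (d := d) (γ := γ) (R := R) (n := n) (a := a) (b := b) (s := s) hγ
  obtain ⟨⟨W, hW⟩, h⟩ := coeffFun_polyBdd hγ hX hc ha hb (fun _ => hs) n le_rfl
  obtain ⟨m, hm⟩ := (hW.of_le (by omega) : PolyBdd R size W (k + 1) _).contDiffOn_and_abs_partialD_le
    (h.of_le (by omega))
  exact ⟨m, fun i u hu t ht => hm i ⟨t, ht⟩ _
    (eq_coeffFun hγ hX (by omega) (by omega) (fun _ => by omega) i hu le_rfl ht)⟩

/-- The two terms of the constant come from comparing `u_{n+1}(x,t)` with `u_{n+1}(0,t)` through the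
gradient bound, and from the tail of the integral at the origin. -/
theorem exists_integral_opL2_bound (hγ : 0 < γ) (hR : 0 < R) (hc : 0 < c) (hcγ : c < γ)
    (ha : 1 + 2 * (n + 1) ≤ a) (hb : 2 + 2 * (n + 1) ≤ b) (hs : 2 * (n + 1) - 1 ≤ s) : ∃ m m' : ℕ,
    ∀ (i : Datum d γ R (n + 1) a b s) (u : ℕ → E d → ℝ → ℝ),
      IsCoeffs R i.f i.S i.φ (n + 1) u →
        IntegrableOn (fun t => opL2 i.f i.S (fun y => u n y t) 0) (Ioi 0) ∧
        ∀ t ≥ 0, ∀ x ∈ ball (0 : E d) R,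
          |u (n + 1) x t - ∫ r in Ioi (0 : ℝ), opL2 i.f i.S (fun y => u n y r) 0| ≤
            (R * i.size ^ m + i.size ^ m' / c) * Real.exp (-c * t) := by
  obtain ⟨X, hX⟩ := exists_flow (d := d) (γ := γ) (R := R) (n := n + 1) (a := a) (b := b) (s := s)
    hγ
  obtain ⟨⟨W, hW⟩, h⟩ := coeffFun_polyBdd (k := 0) hγ hX hcγ (by omega) (by omega)
    (fun _ => by omega) (n + 1) le_rfl
  obtain ⟨m, hm⟩ := h.unifBdd.2
  have hL := opL2_coeffFun_unifBdd (k := 0) hγ hX hcγ (by omega) (by omega)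
    (fun _ => by omega) n n.lt_succ_self
  obtain ⟨m', hm'⟩ := hL.2
  refine ⟨m, m', fun i u hu => ?_⟩
  have h0 : (0 : E d) ∈ ball (0 : E d) R := mem_ball_self hR
  have hueq := fun {l : ℕ} (hl : l ≤ n + 1) {t : ℝ} (ht : 0 ≤ t) =>
    eq_coeffFun hγ hX (by omega) (by omega) (fun _ => by omega) i hu hl ht
  set g : ℝ → ℝ := fun t => opL2 i.f i.S (coeffFun i.f i.S i.φ (X i) n t) 0 with hg
  have hug : ∀ t, 0 ≤ t → opL2 i.f i.S (fun y => u n y t) 0 = g t := fun t ht =>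
    opL2_congr (hueq n.le_succ ht) h0
  have hgc : ContinuousOn g (Ici 0) := by
    rw [continuousOn_iff_continuous_domRestrict]
    exact (hL.1 i).comp (f := fun t : Ici (0 : ℝ) => ((⟨t, t.2⟩ : ℝ≥0), (⟨0, h0⟩ : ball (0 : E d) R)))
      (Continuous.prodMk (Continuous.subtype_mk continuous_subtype_val _) continuous_const)
  have hgb : ∀ t, 0 ≤ t → |g t| ≤ i.size ^ m' * Real.exp (-c * t) := fun t ht =>
    hm' i ⟨t, ht⟩ 0 h0
  have hexp : IntegrableOn (fun t => i.size ^ m' * Real.exp (-c * t)) (Ioi 0) :=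
    (integrableOn_exp_mul_Ioi (neg_lt_zero.2 hc) 0).const_mul _
  have hgi : IntegrableOn g (Ioi 0) :=
    hexp.mono' ((hgc.mono Ioi_subset_Ici_self).aestronglyMeasurable measurableSet_Ioi)
      ((ae_restrict_iff' measurableSet_Ioi).2 (.of_forall fun t ht => hgb t (le_of_lt ht)))
  have hint : ∫ r in Ioi (0 : ℝ), opL2 i.f i.S (fun y => u n y r) 0 = ∫ r in Ioi (0 : ℝ), g r :=
    setIntegral_congr_fun measurableSet_Ioi fun t ht => hug t (le_of_lt ht)
  refine ⟨hgi.congr_fun (fun t ht => (hug t (le_of_lt ht)).symm) measurableSet_Ioi,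
    fun t ht x hx => ?_⟩
  rw [hint, show u (n + 1) x t = _ from hueq le_rfl ht hx]
  -- The origin is an equilibrium of the flow, so transport disappears from Duhamel's formula there.
  have hzero : coeffFun i.f i.S i.φ (X i) (n + 1) t 0 = ∫ r in (0 : ℝ)..t, g r := by
    refine intervalIntegral.integral_congr fun r hr => ?_
    rw [uIcc_of_le ht] at hr
    simp only [hg]
    rw [(hX i).zero i.isMonotoneField hR (sub_nonneg.2 hr.2)]
  have h1 : |coeffFun i.f i.S i.φ (X i) (n + 1) t x - coeffFun i.f i.S i.φ (X i) (n + 1) t 0| ≤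
      i.size ^ m * Real.exp (-c * t) * R := by
    refine (norm_sub_le_of_norm_fderiv_le (C := i.size ^ m * Real.exp (-c * t))
      ((hW.of_le (by omega) : PolyBdd R size W (0 + 1) _).2.1 i ⟨t, ht⟩)
      (hm i ⟨t, ht⟩) hx).trans ?_
    have := two_le_size i
    gcongr
    exact (mem_ball_zero_iff.1 hx).le
  have h2 : |(∫ r in (0 : ℝ)..t, g r) - ∫ r in Ioi (0 : ℝ), g r| ≤
      i.size ^ m' * (Real.exp (-c * t) / c) := by
    have hsub : Ioi t ⊆ Ioi (0 : ℝ) := Ioi_subset_Ioi ht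
    rw [← intervalIntegral.integral_Ioi_sub_Ioi hgi ht, sub_sub_cancel_left, abs_neg]
    refine (norm_integral_le_of_norm_le (f := g) (hexp.mono_set hsub)
      ((ae_restrict_iff' measurableSet_Ioi).2
        (.of_forall fun r hr => hgb r (ht.trans (le_of_lt hr))))).trans_eq ?_
    rw [integral_const_mul, integral_exp_mul_Ioi (neg_lt_zero.2 hc), neg_div_neg_eq]
  rw [hzero] at h1
  calc _ ≤ _ := _root_.abs_sub_le _ (∫ r in (0 : ℝ)..t, g r) _
    _ ≤ _ := add_le_add h1 h2
    _ = _ := by ring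

end Datum

end DecayEstimates

end SGDExpansion

theorem theorem1 (d : ℕ) (γ R : ℝ) (hγ : 0 < γ) (hR : 0 < R) :
    -- (i), existence of `u₀` and its convergence to `φ(0)`
    (∀ (Ξ : Type*) [MeasurableSpace Ξ] (μ : Measure Ξ) (F : Ξ → E d → ℝ) (f : E d → ℝ) (b R₁ : ℝ),
      Assumptions μ F f γ b R₁ → 16 * b / (3 * γ) < R → R ≤ R₁ →
      ∀ φ : E d → ℝ, IsCk 1 R φ →
        (∃ u, IsCoeffs R f (noiseCov μ F f) φ 0 u) ∧
        ∀ u, IsCoeffs R f (noiseCov μ F f) φ 0 u →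
          ∀ t ≥ 0, ∀ x ∈ ball (0 : E d) R,
            |u 0 x t - φ 0| ≤ R * normCk 1 R φ * Real.exp (-γ * t)) ∧
    -- (i), decay of the derivatives of `u₀`
    (∀ k : ℕ, 1 ≤ k → ∃ P : MvPolynomial (Fin 2) ℝ,
      ∀ (Ξ : Type*) [MeasurableSpace Ξ] (μ : Measure Ξ) (F : Ξ → E d → ℝ) (f : E d → ℝ)
        (b R₁ : ℝ),
      Assumptions μ F f γ b R₁ → 16 * b / (3 * γ) < R → R ≤ R₁ →
      ∀ φ : E d → ℝ, IsCk k R φ → IsCk (k + 1) R f →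
        ∀ u, IsCoeffs R f (noiseCov μ F f) φ 0 u →
          ∀ t ≥ 0, ContDiffOn ℝ k (fun y => u 0 y t) (ball (0 : E d) R) ∧
            ∀ J : Fin k → Fin d, ∀ x ∈ ball (0 : E d) R,
              |partialD J (fun y => u 0 y t) x| ≤
                MvPolynomial.eval ![normCk k R φ, normCk (k + 1) R f] P * Real.exp (-γ * t)) ∧
    -- (ii), existence of `u_n` and its convergence to the constant `φ_n`
    (∀ n : ℕ, 1 ≤ n → ∀ γ' < γ, ∃ P : MvPolynomial (Fin 3) ℝ,
      ∀ (Ξ : Type*) [MeasurableSpace Ξ] (μ : Measure Ξ) (F : Ξ → E d → ℝ) (f : E d → ℝ)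
        (b R₁ : ℝ),
      Assumptions μ F f γ b R₁ → 16 * b / (3 * γ) < R → R ≤ R₁ →
      ∀ φ : E d → ℝ, IsCk (2 * n + 1) R φ → IsCk (2 * n + 2) R f →
        IsCk (2 * n - 1) R (noiseCov μ F f) →
        (∃ u, IsCoeffs R f (noiseCov μ F f) φ n u) ∧
        ∀ u, IsCoeffs R f (noiseCov μ F f) φ n u →
          IntegrableOn (fun s => opL2 f (noiseCov μ F f) (fun y => u (n - 1) y s) 0) (Ioi 0) ∧
          ∀ t ≥ 0, ∀ x ∈ ball (0 : E d) R,
            |u n x t - ∫ s in Ioi (0 : ℝ),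
                opL2 f (noiseCov μ F f) (fun y => u (n - 1) y s) 0| ≤
              MvPolynomial.eval ![normCk (2 * n + 1) R φ, normCk (2 * n + 2) R f,
                normCk (2 * n - 1) R (noiseCov μ F f)] P * Real.exp (-γ' * t)) ∧
    -- (ii), decay of the derivatives of `u_n`
    (∀ n : ℕ, 1 ≤ n → ∀ k : ℕ, 1 ≤ k → ∀ γ'' < γ, ∃ P : MvPolynomial (Fin 3) ℝ,
      ∀ (Ξ : Type*) [MeasurableSpace Ξ] (μ : Measure Ξ) (F : Ξ → E d → ℝ) (f : E d → ℝ)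
        (b R₁ : ℝ),
      Assumptions μ F f γ b R₁ → 16 * b / (3 * γ) < R → R ≤ R₁ →
      ∀ φ : E d → ℝ, IsCk (k + 2 * n) R φ → IsCk (k + 1 + 2 * n) R f →
        IsCk (k + 2 * n - 2) R (noiseCov μ F f) →
        ∀ u, IsCoeffs R f (noiseCov μ F f) φ n u →
          ∀ t ≥ 0, ContDiffOn ℝ k (fun y => u n y t) (ball (0 : E d) R) ∧
            ∀ J : Fin k → Fin d, ∀ x ∈ ball (0 : E d) R,
              |partialD J (fun y => u n y t) x| ≤
                MvPolynomial.eval ![normCk (k + 2 * n) R φ, normCk (k + 1 + 2 * n) R f,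
                  normCk (k + 2 * n - 2) R (noiseCov μ F f)] P * Real.exp (-γ'' * t)) := by
  refine ⟨fun Ξ _ μ F f b R₁ h _ hR₁ φ hφ => ?_, fun k hk => ?_, fun n hn γ' hγ' => ?_,
    fun n hn k hk γ'' hγ'' => ?_⟩
  · let i : Datum d γ R 0 1 2 0 := ⟨f, noiseCov μ F f, φ, h.isMonotoneField hR₁, hφ,
      isCk_of_contDiff (h.contDiff.of_le (by norm_num)), fun h => absurd rfl h⟩
    exact ⟨Datum.exists_isCoeffs hγ (by norm_num) (by norm_num) (by simp) i,
      fun u hu t ht x hx => i.abs_sub_le hγ hu ht hx⟩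
  · obtain ⟨k, rfl⟩ := Nat.exists_eq_add_of_le' hk
    obtain ⟨m, hm⟩ := Datum.exists_partialD_zero_le (d := d) (R := R) hγ k
    refine ⟨(MvPolynomial.C 2 + MvPolynomial.X 0 + MvPolynomial.X 1) ^ m,
      fun Ξ _ μ F f b R₁ h _ hR₁ φ hφ hf u hu t ht => ?_⟩
    have := hm ⟨f, noiseCov μ F f, φ, h.isMonotoneField hR₁, hφ, hf, fun h => absurd rfl h⟩ u hu t ht
    simpa [Datum.size] using this
  · obtain ⟨n, rfl⟩ := Nat.exists_eq_add_of_le' hn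
    -- Integrability on the half-line needs a positive rate, while `γ'` may be zero or negative; the
    -- larger rate implies the claimed one.
    have hc : 0 < max γ' (γ / 2) := lt_max_of_lt_right (half_pos hγ)
    obtain ⟨m, m', hm⟩ := Datum.exists_integral_opL2_bound (d := d) (R := R) (c := max γ' (γ / 2))
      (n := n) (a := 2 * (n + 1) + 1) (b := 2 * (n + 1) + 2) (s := 2 * (n + 1) - 1) hγ hR
      hc (max_lt hγ' (half_lt_self hγ)) (by omega) (by omega) le_rfl
    -- The constant of `exists_integral_opL2_bound`, with `size` expanded as `2` plus the three
    -- norms.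
    refine ⟨MvPolynomial.C R *
        (MvPolynomial.C 2 + MvPolynomial.X 0 + MvPolynomial.X 1 + MvPolynomial.X 2) ^ m +
        (MvPolynomial.C 2 + MvPolynomial.X 0 + MvPolynomial.X 1 + MvPolynomial.X 2) ^ m' *
          MvPolynomial.C (max γ' (γ / 2))⁻¹,
      fun Ξ _ μ F f b R₁ h _ hR₁ φ hφ hf hS => ?_⟩
    let i : Datum d γ R (n + 1) (2 * (n + 1) + 1) (2 * (n + 1) + 2) (2 * (n + 1) - 1) :=
      ⟨f, noiseCov μ F f, φ, h.isMonotoneField hR₁, hφ, hf, fun _ => hS⟩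
    refine ⟨Datum.exists_isCoeffs hγ (by omega) (by omega) (fun _ => le_rfl) i, fun u hu => ?_⟩
    obtain ⟨hint, hle⟩ := hm i u hu
    refine ⟨hint, fun t ht x hx => (hle t ht x hx).trans ?_⟩
    have hsize : i.size = 2 + normCk (2 * (n + 1) + 1) R φ + normCk (2 * (n + 1) + 2) R f +
      normCk (2 * (n + 1) - 1) R (noiseCov μ F f) := by simp [Datum.size, i]
    have h2 := i.two_le_size
    have hexp : Real.exp (-max γ' (γ / 2) * t) ≤ Real.exp (-γ' * t) := by
      gcongr
      exact le_max_left _ _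
    refine (mul_le_mul_of_nonneg_left hexp (by positivity)).trans_eq ?_
    rw [hsize, div_eq_mul_inv]
    simp
  · obtain ⟨k, rfl⟩ := Nat.exists_eq_add_of_le' hk
    obtain ⟨m, hm⟩ := Datum.exists_partialD_le (d := d) (R := R) (n := n) (k := k)
      (a := k + 1 + 2 * n) (b := k + 1 + 1 + 2 * n) (s := k + 1 + 2 * n - 2) hγ hγ''
      le_rfl le_rfl (by omega)
    refine ⟨(MvPolynomial.C 2 + MvPolynomial.X 0 + MvPolynomial.X 1 + MvPolynomial.X 2) ^ m,
      fun Ξ _ μ F f b R₁ h _ hR₁ φ hφ hf hS u hu t ht => ?_⟩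
    have := hm ⟨f, noiseCov μ F f, φ, h.isMonotoneField hR₁, hφ, hf, fun _ => hS⟩ u hu t ht
    simpa [Datum.size, show n ≠ 0 by omega] using this
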